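/- Let $(N_1,\tau_1)$ and $(N_2,\tau_2)$ be finite von Neumann algebras with faithful normal tracial states and with a common (unital) von Neumann subalgebra $B$ such that $\tau_1|_B=\tau_2|_B$. Suppose that $B\subset N_1$ admits an infinite Pimsner–Popa basis consisting of unitaries, that is, an infinite family $(u_i)_{i\in I}$ of unitaries of $N_1$ such that $E_B(u_i^*u_j)=0$ for $i\ne j$, $L^2(N_1,\tau_1)=\bigoplus_i u_iL^2(B)$, and $x=\sum_i u_iE_B(u_i^*x)$ in $\|\cdot\|_2$ for every $x\in N_1$, where $E_B$ denotes the trace-preserving conditional expectation onto $B$. Let $M=N_1*_BN_2$ be the amalgamated free product with its canonical faithful normal trace $\tau=\tau_B\circ E_B$, where $\tau_B=\tau_1|_B$. Then $N_1\subset M$ has the asymptotic orthogonality property: for every free ultrafilter $\omega$ on $\mathbb N$, all $y_1,y_2\in M\ominus N_1=\{y\in M: \tau(z^*y)=0\ \text{for all } z\in N_1\}$ and every $x\in N_1'\cap(M^\omega\ominus N_1^\omega)$, the vectors $xy_1$ and $y_2x$ are orthogonal in $L^2(M^\omega,\tau_\omega)$, that is, $\tau_\omega\big((y_2x)^*xy_1\big)=0$.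 Here $M^\omega$ is the tracial ultrapower (the norm-bounded sequences in $M$ modulo those with $\lim_{n\to\omega}\|x_n\|_2=0$), $\tau_\omega((x_n)_n)=\lim_{n\to\omega}\tau(x_n)$, $M$ is embedded in $M^\omega$ by constant sequences, and $M^\omega\ominus N_1^\omega=\{x\in M^\omega:\tau_\omega(z^*x)=0\ \text{for all } z\in N_1^\omega\}$. -/

import Mathlib

open scoped InnerProductSpace ComplexOrder ComplexConjugate Topology
open Filter

noncomputable section

namespace TracialVN

/-! ### Positive functionals on unital `*`-algebras and their `L²`-spaces -/

/-- A positive linear functional on a unital complex `*`-algebra. -/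
structure PosFunctional (A : Type*) [Ring A] [StarRing A] [Algebra ℂ A] extends A →ₗ[ℂ] ℂ where
  nonneg' : ∀ x : A, 0 ≤ toLinearMap (star x * x)

section L2

variable {A : Type*} [Ring A] [StarRing A] [Algebra ℂ A]

instance : CoeFun (PosFunctional A) (fun _ => A → ℂ) := ⟨fun τ => τ.toLinearMap⟩

variable (τ : PosFunctional A)

theorem PosFunctional.nonneg (x : A) : 0 ≤ τ (star x * x) := τ.nonneg' x

variable [StarModule ℂ A]

theorem PosFunctional.map_star (x : A) : τ (star x) = conj (τ x) := by
  have key : ∀ y : A, (τ y).im + (τ (star y)).im = 0 := by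
    intro y
    have h := (Complex.nonneg_iff.1 (τ.nonneg (1 + y))).2
    have h1 := (Complex.nonneg_iff.1 (τ.nonneg (1 : A))).2
    have h2 := (Complex.nonneg_iff.1 (τ.nonneg y)).2
    have e : star (1 + y) * (1 + y) = star (1 : A) * 1 + y + star y + star y * y := by
      simp only [star_add, mul_add, add_mul, star_one, one_mul, mul_one]
      abel
    rw [e, map_add, map_add, map_add, Complex.add_im, Complex.add_im, Complex.add_im] at h
    linarith
  have h1 := key x
  have h2 := key (Complex.I • x)
  rw [star_smul, map_smul, map_smul] at h2
  simp at h2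
  apply Complex.ext
  · simp; linarith
  · simp; linarith

/-- The algebra `A`, regarded as a pre-Hilbert space for the inner product `τ(x* y)`. -/
def PreL2 (_τ : PosFunctional A) : Type _ := A

instance : AddCommGroup (PreL2 τ) := inferInstanceAs (AddCommGroup A)

instance : Module ℂ (PreL2 τ) := inferInstanceAs (Module ℂ A)

/-- The identity map from `A` to `PreL2 τ`. -/
def toPreL2 : A ≃ₗ[ℂ] PreL2 τ := LinearEquiv.refl ℂ _

/-- The semi-inner product `⟨x, y⟩ = τ(x* y)`, conjugate-linear in the first variable. -/
abbrev preL2Core : PreInnerProductSpace.Core ℂ (PreL2 τ) where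
  inner x y := τ (star ((toPreL2 τ).symm x) * (toPreL2 τ).symm y)
  conj_inner_symm x y := by rw [← τ.map_star]; simp
  re_inner_nonneg x := (Complex.nonneg_iff.1 (τ.nonneg _)).1
  add_left x y z := by simp [add_mul]
  smul_left x y r := by simp

instance : SeminormedAddCommGroup (PreL2 τ) :=
  InnerProductSpace.Core.toSeminormedAddCommGroup (c := preL2Core τ)

instance : InnerProductSpace ℂ (PreL2 τ) := InnerProductSpace.ofCore (preL2Core τ)

/-- The Hilbert space `L²(A, τ)`. -/
abbrev L2 : Type _ := UniformSpace.Completion (PreL2 τ)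

/-- The canonical map `A → L²(A, τ)`, `x ↦ x̂`. -/
def toL2 : A →ₗ[ℂ] L2 τ :=
  (UniformSpace.Completion.toComplₗᵢ (𝕜 := ℂ) (E := PreL2 τ)).toLinearMap ∘ₗ
    (toPreL2 τ).toLinearMap

theorem inner_toL2 (x y : A) : ⟪toL2 τ x, toL2 τ y⟫_ℂ = τ (star x * y) :=
  UniformSpace.Completion.inner_coe _ _

theorem norm_toL2_sq (x : A) : ‖toL2 τ x‖ ^ 2 = (τ (star x * x)).re := by
  rw [← inner_toL2, ← inner_self_eq_norm_sq (𝕜 := ℂ)]; rfl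

/-- `A ⊖ S`: the elements of `A` that are orthogonal to `S` in `L²(A, τ)`. -/
def ominus (S : Set A) : Set A := {x | ∀ z ∈ S, ⟪toL2 τ z, toL2 τ x⟫_ℂ = 0}

end L2

/-! ### Finite von Neumann algebras with a trace -/

/-- A finite von Neumann algebra `(M, τ)`: a von Neumann algebra acting on the Hilbert space `H`,
with a faithful normal tracial state. Normality is ultraweak continuity: `τ` is a sum of vector
functionals `x ↦ ⟨ηₙ, x ξₙ⟩` with `∑ ‖ξₙ‖² < ∞` and `∑ ‖ηₙ‖² < ∞`. -/
structure TracialVNA (H : Type*) [NormedAddCommGroup H] [InnerProductSpace ℂ H]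
    [CompleteSpace H] where
  alg : VonNeumannAlgebra H
  tr : PosFunctional alg.toStarSubalgebra
  tr_one : tr 1 = 1
  tr_mul_comm : ∀ x y, tr (x * y) = tr (y * x)
  faithful : ∀ x, tr (star x * x) = 0 → x = 0
  normal : ∃ ξ η : ℕ → H, Summable (fun n => ‖ξ n‖ ^ 2) ∧ Summable (fun n => ‖η n‖ ^ 2) ∧
    ∀ x : alg.toStarSubalgebra, HasSum (fun n => ⟪η n, (x : H →L[ℂ] H) (ξ n)⟫_ℂ) (tr x)

section Algebra

variable {H : Type*} [NormedAddCommGroup H] [InnerProductSpace ℂ H] [CompleteSpace H]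

/-- The underlying `*`-algebra of `M`. -/
abbrev TracialVNA.Carrier (M : TracialVNA H) : Type _ := M.alg.toStarSubalgebra

instance : CoeSort (TracialVNA H) (Type _) := ⟨TracialVNA.Carrier⟩

variable (M : TracialVNA H)

theorem TracialVNA.isClosed : IsClosed (M.alg.toStarSubalgebra : Set (H →L[ℂ] H)) := by
  have h := M.alg.centralizer_centralizer
  rw [VonNeumannAlgebra.coe_toStarSubalgebra, ← h]
  exact Set.isClosed_centralizer _

theorem exists_norm_sq_sub_star_mul_self {A : Type*} [CStarAlgebra A] (x : A) :
    ∃ z : A, ((‖x‖ ^ 2 : ℝ) : ℂ) • (1 : A) - star x * x = star z * z := by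
  let _ := CStarAlgebra.spectralOrder A
  have _ := CStarAlgebra.spectralOrderedRing A
  refine CStarAlgebra.nonneg_iff_eq_star_mul_self.1 (sub_nonneg.2 ?_)
  have h := CStarAlgebra.star_mul_le_algebraMap_norm_sq (a := x)
  rwa [Algebra.algebraMap_eq_smul_one, ← Complex.coe_smul] at h

/-- `‖x‖² - x* x` is of the form `z* z` with `z ∈ M`. -/
theorem TracialVNA.exists_star_mul_self (x : M) :
    ∃ z : M, ((‖x‖ ^ 2 : ℝ) : ℂ) • (1 : M) - star x * x = star z * z :=
  @exists_norm_sq_sub_star_mul_self M (StarSubalgebra.cstarAlgebra _ (h_closed := M.isClosed)) x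

theorem TracialVNA.norm_toL2_mul_le (x y : M) :
    ‖toL2 M.tr (x * y)‖ ≤ ‖x‖ * ‖toL2 M.tr y‖ := by
  refine le_of_sq_le_sq ?_ (by positivity)
  obtain ⟨z, hz⟩ := M.exists_star_mul_self x
  have h := (Complex.nonneg_iff.1 (M.tr.nonneg (z * y))).1
  have e : star (z * y) * (z * y) =
      ((‖x‖ ^ 2 : ℝ) : ℂ) • (star y * y) - star (x * y) * (x * y) := by
    have : star (z * y) * (z * y) = star y * (star z * z) * y := by
      simp [mul_assoc]
    rw [this, ← hz, mul_sub, sub_mul]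
    simp [mul_assoc]
  rw [e, map_sub, map_smul, smul_eq_mul, Complex.sub_re, Complex.re_ofReal_mul] at h
  rw [mul_pow, norm_toL2_sq, norm_toL2_sq]
  linarith

theorem TracialVNA.norm_toL2_star (x : M) : ‖toL2 M.tr (star x)‖ = ‖toL2 M.tr x‖ := by
  rw [← sq_eq_sq₀ (norm_nonneg _) (norm_nonneg _), norm_toL2_sq, norm_toL2_sq, star_star,
    M.tr_mul_comm]

theorem TracialVNA.norm_toL2_mul_le' (x y : M) :
    ‖toL2 M.tr (x * y)‖ ≤ ‖toL2 M.tr x‖ * ‖y‖ := by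
  rw [← M.norm_toL2_star, star_mul, mul_comm]
  refine (M.norm_toL2_mul_le _ _).trans ?_
  rw [M.norm_toL2_star, norm_star]

theorem TracialVNA.norm_toL2_one : ‖toL2 M.tr 1‖ = 1 := by
  have : ‖toL2 M.tr 1‖ ^ 2 = 1 := by rw [norm_toL2_sq]; simp [M.tr_one]
  exact (pow_eq_one_iff_of_nonneg (norm_nonneg _) two_ne_zero).1 this

theorem TracialVNA.norm_toL2_le (x : M) : ‖toL2 M.tr x‖ ≤ ‖x‖ := by
  simpa [M.norm_toL2_one] using M.norm_toL2_mul_le x 1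

theorem TracialVNA.norm_tr_le (x : M) : ‖M.tr x‖ ≤ ‖toL2 M.tr x‖ := by
  have h := norm_inner_le_norm (𝕜 := ℂ) (toL2 M.tr 1) (toL2 M.tr x)
  rw [inner_toL2, M.norm_toL2_one] at h
  simpa using h

end Algebra

/-! ### Tracial ultrapowers -/

section Ultrapower

variable {H : Type*} [NormedAddCommGroup H] [InnerProductSpace ℂ H] [CompleteSpace H]
variable (M : TracialVNA H) (ω : Ultrafilter ℕ)

/-- `ℓ^∞(ℕ, M)`: the operator-norm bounded sequences in `M`. -/
def BddSeq : StarSubalgebra ℂ (ℕ → M) where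
  carrier := {x | ∃ C : ℝ, ∀ n, ‖x n‖ ≤ C}
  mul_mem' := by
    rintro x y ⟨C, hC⟩ ⟨D, hD⟩
    exact ⟨C * D, fun n => (norm_mul_le _ _).trans
      (mul_le_mul (hC n) (hD n) (norm_nonneg _) ((norm_nonneg _).trans (hC n)))⟩
  add_mem' := by
    rintro x y ⟨C, hC⟩ ⟨D, hD⟩
    exact ⟨C + D, fun n => (norm_add_le _ _).trans (add_le_add (hC n) (hD n))⟩
  algebraMap_mem' r := ⟨‖algebraMap ℂ M r‖, fun _ => le_rfl⟩
  star_mem' := by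
    rintro x ⟨C, hC⟩
    exact ⟨C, fun n => by simpa using hC n⟩

/-- The constant sequences. -/
def constSeq (y : M) : BddSeq M := ⟨fun _ => y, ‖y‖, fun _ => le_rfl⟩

/-- The ideal of the bounded sequences with `‖xₙ‖₂ → 0` along `ω`. -/
def nullIdeal : Ideal (BddSeq M) where
  carrier := {x | Tendsto (fun n => ‖toL2 M.tr ((x : ℕ → M) n)‖) ω (𝓝 0)}
  add_mem' := by
    intro x y hx hy
    refine squeeze_zero (fun _ => norm_nonneg _) (fun n => ?_) (by simpa using hx.add hy)
    simpa using norm_add_le (toL2 M.tr ((x : ℕ → M) n)) (toL2 M.tr ((y : ℕ → M) n))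
  zero_mem' := by simp
  smul_mem' := by
    rintro ⟨c, C, hC⟩ x hx
    refine squeeze_zero (fun _ => norm_nonneg _) (fun n => ?_) (by simpa using hx.const_mul C)
    exact (M.norm_toL2_mul_le _ _).trans (mul_le_mul_of_nonneg_right (hC n) (norm_nonneg _))

theorem mem_nullIdeal {x : BddSeq M} :
    x ∈ nullIdeal M ω ↔ Tendsto (fun n => ‖toL2 M.tr ((x : ℕ → M) n)‖) ω (𝓝 0) := Iff.rfl

instance : (nullIdeal M ω).IsTwoSided where
  mul_mem_of_left := by
    rintro x ⟨c, C, hC⟩ hx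
    rw [mem_nullIdeal] at hx ⊢
    refine squeeze_zero (fun _ => norm_nonneg _) (fun n => ?_) (by simpa using hx.mul_const C)
    exact (M.norm_toL2_mul_le' _ _).trans (mul_le_mul_of_nonneg_left (hC n) (norm_nonneg _))

theorem star_mem_nullIdeal {x : BddSeq M} (hx : x ∈ nullIdeal M ω) :
    star x ∈ nullIdeal M ω := by
  rw [mem_nullIdeal] at hx ⊢
  refine hx.congr fun n => ?_
  exact (M.norm_toL2_star _).symm

/-- The tracial ultrapower `M^ω`: bounded sequences modulo the ideal of null sequences. -/
def Ultrapower : Type _ := BddSeq M ⧸ nullIdeal M ω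

instance : Ring (Ultrapower M ω) := inferInstanceAs (Ring (BddSeq M ⧸ nullIdeal M ω))

instance : Algebra ℂ (Ultrapower M ω) :=
  inferInstanceAs (Algebra ℂ (BddSeq M ⧸ nullIdeal M ω))

/-- The quotient map, sending a bounded sequence to its class in `M^ω`. -/
def Ultrapower.mk : BddSeq M →ₐ[ℂ] Ultrapower M ω := Ideal.Quotient.mkₐ ℂ (nullIdeal M ω)

theorem Ultrapower.mk_surjective : Function.Surjective (Ultrapower.mk M ω) :=
  Ideal.Quotient.mk_surjective

theorem Ultrapower.mk_eq_mk_iff {x y : BddSeq M} :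
    Ultrapower.mk M ω x = Ultrapower.mk M ω y ↔ x - y ∈ nullIdeal M ω :=
  Ideal.Quotient.eq

/-- The involution of `M^ω`, induced by the involution of `ℓ^∞(ℕ, M)`. -/
instance : Star (Ultrapower M ω) where
  star := Quotient.map' star (by
    intro x y h
    rw [Submodule.quotientRel_def] at h ⊢
    have e : star x - star y = star (x - y) := (star_sub x y).symm
    rw [e]
    exact star_mem_nullIdeal M ω h)

theorem Ultrapower.star_mk (x : BddSeq M) :
    star (Ultrapower.mk M ω x) = Ultrapower.mk M ω (star x) := rfl

instance : StarRing (Ultrapower M ω) where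
  star_involutive := by
    intro x
    obtain ⟨x, rfl⟩ := Ultrapower.mk_surjective M ω x
    rw [Ultrapower.star_mk, Ultrapower.star_mk, star_star]
  star_mul := by
    intro x y
    obtain ⟨x, rfl⟩ := Ultrapower.mk_surjective M ω x
    obtain ⟨y, rfl⟩ := Ultrapower.mk_surjective M ω y
    rw [← map_mul, Ultrapower.star_mk, Ultrapower.star_mk, Ultrapower.star_mk, star_mul, map_mul]
  star_add := by
    intro x y
    obtain ⟨x, rfl⟩ := Ultrapower.mk_surjective M ω x
    obtain ⟨y, rfl⟩ := Ultrapower.mk_surjective M ω y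
    rw [← map_add, Ultrapower.star_mk, Ultrapower.star_mk, Ultrapower.star_mk, star_add, map_add]

instance : StarModule ℂ (Ultrapower M ω) where
  star_smul c x := by
    obtain ⟨x, rfl⟩ := Ultrapower.mk_surjective M ω x
    rw [← map_smul, Ultrapower.star_mk, Ultrapower.star_mk, star_smul, map_smul]

theorem exists_tendsto_tr (x : BddSeq M) :
    ∃ c : ℂ, Tendsto (fun n => M.tr ((x : ℕ → M) n)) ω (𝓝 c) := by
  obtain ⟨C, hC⟩ := x.2
  obtain ⟨c, -, hc⟩ := (isCompact_closedBall (0 : ℂ) C).ultrafilter_le_nhds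
    (ω.map fun n => M.tr ((x : ℕ → M) n)) (by
      rw [Ultrafilter.coe_map, le_principal_iff, mem_map]
      refine Filter.univ_mem' fun n => ?_
      rw [Set.mem_preimage, mem_closedBall_zero_iff]
      exact ((M.norm_tr_le _).trans (M.norm_toL2_le _)).trans (hC n))
  exact ⟨c, hc⟩

/-- The limit `lim_{n → ω} τ(xₙ)` for a bounded sequence `x`. -/
def limTr : BddSeq M →ₗ[ℂ] ℂ where
  toFun x := limUnder ω (fun n => M.tr ((x : ℕ → M) n))
  map_add' x y := by
    have hx := tendsto_nhds_limUnder (exists_tendsto_tr M ω x)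
    have hy := tendsto_nhds_limUnder (exists_tendsto_tr M ω y)
    refine Tendsto.limUnder_eq ((hx.add hy).congr fun n => ?_)
    exact (map_add M.tr.toLinearMap _ _).symm
  map_smul' c x := by
    have hx := tendsto_nhds_limUnder (exists_tendsto_tr M ω x)
    refine Tendsto.limUnder_eq ((hx.const_mul c).congr fun n => ?_)
    exact (map_smul M.tr.toLinearMap _ _).symm

theorem tendsto_limTr (x : BddSeq M) :
    Tendsto (fun n => M.tr ((x : ℕ → M) n)) ω (𝓝 (limTr M ω x)) :=
  tendsto_nhds_limUnder (exists_tendsto_tr M ω x)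

theorem limTr_eq_zero {x : BddSeq M} (hx : x ∈ nullIdeal M ω) : limTr M ω x = 0 :=
  tendsto_nhds_unique (tendsto_limTr M ω x)
    (squeeze_zero_norm (fun _ => M.norm_tr_le _) hx)

/-- The map `M^ω → ℂ`, `(xₙ)ₙ ↦ lim_{n → ω} τ(xₙ)`. -/
def ultraTrFun : Ultrapower M ω → ℂ :=
  Quotient.lift (limTr M ω) (by
    intro x y h
    have h' : x - y ∈ nullIdeal M ω := (Submodule.quotientRel_def _).1 h
    rw [← sub_eq_zero, ← map_sub]
    exact limTr_eq_zero M ω h')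

theorem ultraTrFun_mk (x : BddSeq M) : ultraTrFun M ω (Ultrapower.mk M ω x) = limTr M ω x := rfl

theorem ultraTrFun_add (x y : Ultrapower M ω) :
    ultraTrFun M ω (x + y) = ultraTrFun M ω x + ultraTrFun M ω y := by
  obtain ⟨x, rfl⟩ := Ultrapower.mk_surjective M ω x
  obtain ⟨y, rfl⟩ := Ultrapower.mk_surjective M ω y
  rw [← map_add, ultraTrFun_mk, ultraTrFun_mk, ultraTrFun_mk, map_add]

theorem ultraTrFun_smul (c : ℂ) (x : Ultrapower M ω) :
    ultraTrFun M ω (c • x) = c • ultraTrFun M ω x := by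
  obtain ⟨x, rfl⟩ := Ultrapower.mk_surjective M ω x
  rw [← map_smul, ultraTrFun_mk, ultraTrFun_mk, map_smul]

theorem limTr_nonneg (x : BddSeq M) : 0 ≤ limTr M ω (star x * x) :=
  ge_of_tendsto' (tendsto_limTr M ω (star x * x)) fun n => M.tr.nonneg ((x : ℕ → M) n)

theorem ultraTrFun_nonneg (x : Ultrapower M ω) : 0 ≤ ultraTrFun M ω (star x * x) := by
  obtain ⟨x, rfl⟩ := Ultrapower.mk_surjective M ω x
  rw [Ultrapower.star_mk, ← map_mul, ultraTrFun_mk]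
  exact limTr_nonneg M ω x

/-- The trace `τ_ω` on `M^ω`, given by `τ_ω((xₙ)ₙ) = lim_{n → ω} τ(xₙ)`. -/
def ultraTr : PosFunctional (Ultrapower M ω) where
  toFun := ultraTrFun M ω
  map_add' := ultraTrFun_add M ω
  map_smul' := ultraTrFun_smul M ω
  nonneg' := ultraTrFun_nonneg M ω

theorem tendsto_ultraTr (x : BddSeq M) :
    Tendsto (fun n => M.tr ((x : ℕ → M) n)) ω (𝓝 (ultraTr M ω (Ultrapower.mk M ω x))) :=
  tendsto_limTr M ω x

/-- The canonical embedding `M → M^ω` as (classes of) constant sequences. -/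
def toUltra (y : M) : Ultrapower M ω := Ultrapower.mk M ω (constSeq M y)

/-- For `N ⊆ M`, the subset `N^ω ⊆ M^ω` of the classes of bounded sequences in `N`. -/
def subUltra (N : Set M) : Set (Ultrapower M ω) :=
  Ultrapower.mk M ω '' {x | ∀ n, (x : ℕ → M) n ∈ N}

end Ultrapower

/-! ### Inclusions, Pimsner–Popa bases, amalgamated free products -/

section Inclusions

variable {HB HN HN₁ HN₂ HM : Type*}
  [NormedAddCommGroup HB] [InnerProductSpace ℂ HB] [CompleteSpace HB]
  [NormedAddCommGroup HN] [InnerProductSpace ℂ HN] [CompleteSpace HN]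
  [NormedAddCommGroup HN₁] [InnerProductSpace ℂ HN₁] [CompleteSpace HN₁]
  [NormedAddCommGroup HN₂] [InnerProductSpace ℂ HN₂] [CompleteSpace HN₂]
  [NormedAddCommGroup HM] [InnerProductSpace ℂ HM] [CompleteSpace HM]

/-- A unital trace-preserving inclusion `(B, τ_B) ⊆ (N, τ_N)`. As the traces are faithful and
normal, such a `*`-homomorphism is automatically injective and normal, and its range is a von
Neumann subalgebra of `N`. -/
structure Inclusion (B : TracialVNA HB) (N : TracialVNA HN) extends B →⋆ₐ[ℂ] N where
  tr_map : ∀ b : B, N.tr (toStarAlgHom b) = B.tr b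

instance (B : TracialVNA HB) (N : TracialVNA HN) : CoeFun (Inclusion B N) (fun _ => B → N) :=
  ⟨fun i => i.toStarAlgHom⟩

/-- The composite of two inclusions. -/
def Inclusion.comp {B : TracialVNA HB} {N : TracialVNA HN} {M : TracialVNA HM}
    (j : Inclusion N M) (i : Inclusion B N) : Inclusion B M where
  toStarAlgHom := j.toStarAlgHom.comp i.toStarAlgHom
  tr_map b := (j.tr_map (i b)).trans (i.tr_map b)

/-- `i.IsCondExp x e` says `E_B(x) = e`, where `E_B : N → B` is the trace-preserving conditional
expectation: `e` is the unique element of `B` such that `τ_N(b x) = τ_B(b e)` for all `b ∈ B`. -/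
def Inclusion.IsCondExp {B : TracialVNA HB} {N : TracialVNA HN} (i : Inclusion B N)
    (x : N) (e : B) : Prop :=
  ∀ b : B, N.tr (i b * x) = B.tr (b * e)

/-- The closed subspace `m L²(B)` of `L²(N)`, that is, the closure of the set of the vectors
`(m b)^` with `b ∈ B`. -/
def Inclusion.mulL2 {B : TracialVNA HB} {N : TracialVNA HN} (i : Inclusion B N) (m : N) :
    Submodule ℂ (L2 N.tr) :=
  (LinearMap.range (toL2 N.tr ∘ₗ LinearMap.mulLeft ℂ m ∘ₗ
    i.toStarAlgHom.toAlgHom.toLinearMap)).topologicalClosure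

/-- `(m_j)` is a Pimsner–Popa basis of `N` over `B`. -/
structure IsPimsnerPopaBasis {B : TracialVNA HB} {N : TracialVNA HN} (i : Inclusion B N)
    {J : Type*} (m : J → N) : Prop where
  condExp_eq_zero : ∀ j k, j ≠ k → i.IsCondExp (star (m j) * m k) 0
  condExp_isStarProjection : ∀ j, ∃ p : B, IsStarProjection p ∧ i.IsCondExp (star (m j) * m j) p
  isHilbertSum : IsHilbertSum ℂ (fun j => i.mulL2 (m j)) (fun j => (i.mulL2 (m j)).subtypeₗᵢ)
  hasSum : ∀ x : N, ∃ e : J → B, (∀ j, i.IsCondExp (star (m j) * x) (e j)) ∧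
    HasSum (fun j => toL2 N.tr (m j * i (e j))) (toL2 N.tr x)

/-- `(M, τ)`, with the inclusions `j₁ : N₁ ⊆ M` and `j₂ : N₂ ⊆ M`, is the amalgamated free product
`N₁ *_B N₂`: the inclusions agree on `B`, the algebra `M` is generated by `N₁` and `N₂` as a von
Neumann algebra, and `E_B(x₁ x₂ ⋯ xₙ) = 0` for all `n ≥ 1` and all letters `x_k ∈ N_{i_k} ⊖ B` with
`i₁ ≠ i₂ ≠ ⋯ ≠ iₙ`. A word is a list of letters, each tagged by the algebra that it belongs to. -/
structure IsAmalgamatedFreeProduct {B : TracialVNA HB} {N₁ : TracialVNA HN₁}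
    {N₂ : TracialVNA HN₂} (i₁ : Inclusion B N₁) (i₂ : Inclusion B N₂) {M : TracialVNA HM}
    (j₁ : Inclusion N₁ M) (j₂ : Inclusion N₂ M) : Prop where
  comm : ∀ b : B, j₁ (i₁ b) = j₂ (i₂ b)
  generates : Set.centralizer (Set.centralizer
      ((fun x : M => (x : HM →L[ℂ] HM)) '' (Set.range j₁ ∪ Set.range j₂))) =
    (M.alg : Set (HM →L[ℂ] HM))
  free : ∀ w : List (N₁ ⊕ N₂), w ≠ [] →
    w.IsChain (fun a b => a.isLeft ≠ b.isLeft) →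
    (∀ a, Sum.inl a ∈ w → a ∈ ominus N₁.tr (Set.range i₁)) →
    (∀ a, Sum.inr a ∈ w → a ∈ ominus N₂.tr (Set.range i₂)) →
    (j₁.comp i₁).IsCondExp (w.map (Sum.elim j₁ j₂)).prod 0

end Inclusions

end TracialVN

end

open TracialVN

noncomputable section

namespace TracialVN

/-! ### The double commutant theorem on an amplification -/

section Amplification

variable {H : Type*} [NormedAddCommGroup H] [InnerProductSpace ℂ H] {ι : Type*}

/-! Write P₁ = N₁ ⊖ B, P₂ = N₂ ⊖ B, and let W be the span of the alternating words that begin and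
end in P₂. Freeness says that the trace vanishes on N₁ W N₁, and N₁ + N₁ W N₁ is ‖·‖₂-dense in M.
The words in N₁ W N₁ split by their first and last letters into W N₁ (beginning in P₂), P₁ W
(beginning in P₁, ending in P₂) and P₁ W P₁. These spaces are pairwise orthogonal, and orthogonal to
N₁.

Let x commute with N₁ and be orthogonal to N₁^ω. Since uᵢ* uⱼ ∈ P₁ for i ≠ j, the conjugates uᵢ (W
N₁) uᵢ* are pairwise orthogonal, and so are the uᵢ (P₁ W) uᵢ*. As x commutes with every uᵢ, its
components in these infinitely many conjugates have the same norm, so they vanish because ‖x‖₂ is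
finite. Hence x is represented in ‖·‖₂ by some qₙ ∈ P₁ W P₁ (`exists_asympEq`).

For y₁ = a w b and y₂ = a' w' b', moving a' and b' past x turns ⟨x y₁, y₂ x⟩ into ⟨x c w d, w' x⟩
with c = a'* a and d = b b'*. Right multiplication by c spoils only the last letter of qₙ and left
multiplication only the first, so commutation keeps x c asymptotically in P₁ W P₁
(`exists_asympEq_mul`). Now x c w d begins in P₁ and w' x begins in P₂, so they are orthogonal
(`IsFreeSplitting.tendsto_inner`). Density and boundedness of x give arbitrary y₁, y₂ orthogonal to
N₁.

Two analytic facts support the algebra. Density of words follows from the double commutant argument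
on an amplification and normality of the trace. Contractive conditional expectations follow from
truncation and weak compactness; they give N = B + (N ⊖ B) and the vanishing of the N₁-component of
x. -/

/-- The diagonal action of an operator on `ℓ²(ι, H)`. -/
def amplification (a : H →L[ℂ] H) : lp (fun _ : ι => H) 2 →L[ℂ] lp (fun _ : ι => H) 2 :=
  have bound (f : lp (fun _ : ι => H) 2) (k : ι) : ‖a (f k)‖ ≤ ‖((‖a‖ : ℂ) • f) k‖ := by
    rw [lp.coeFn_smul, Pi.smul_apply, norm_smul, Complex.norm_real, norm_norm]
    exact a.le_opNorm (f k)
  LinearMap.mkContinuous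
    { toFun := fun f => ⟨fun k => a (f k), (lp.memℓp ((‖a‖ : ℂ) • f)).mono' (bound f)⟩
      map_add' := fun f g => by ext k; exact map_add a _ _
      map_smul' := fun c f => by ext k; simp } ‖a‖ fun f => by
    refine (lp.norm_mono (y := (‖a‖ : ℂ) • f) two_ne_zero (bound f)).trans ?_
    rw [norm_smul, Complex.norm_real, norm_norm]

@[simp]
theorem amplification_apply (a : H →L[ℂ] H) (f : lp (fun _ : ι => H) 2) (k : ι) :
    amplification a f k = a (f k) := rfl

theorem amplification_single [DecidableEq ι] (a : H →L[ℂ] H) (k : ι) (v : H) :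
    amplification a (lp.single 2 k v) = lp.single 2 k (a v) := by
  ext l
  rw [amplification_apply, lp.single_apply, lp.single_apply]
  rcases eq_or_ne l k with rfl | h
  · simp
  · simp [h]

theorem inner_amplification_left [CompleteSpace H] (a : H →L[ℂ] H) (f g : lp (fun _ : ι => H) 2) :
    ⟪amplification a f, g⟫_ℂ = ⟪f, amplification (star a) g⟫_ℂ := by
  rw [lp.inner_eq_tsum, lp.inner_eq_tsum]
  congr 1
  ext k
  rw [amplification_apply, amplification_apply, ContinuousLinearMap.star_eq_adjoint,
    ContinuousLinearMap.adjoint_inner_right]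

/-- An operator on `ℓ²(ι, H)` that commutes with the diagonal action of `S` commutes with the
diagonal action of the double commutant of `S`. -/
theorem amplification_comm_of_mem_centralizer {S : Set (H →L[ℂ] H)}
    (P : lp (fun _ : ι => H) 2 →L[ℂ] lp (fun _ : ι => H) 2)
    (hP : ∀ a ∈ S, ∀ f, P (amplification a f) = amplification a (P f))
    {y : H →L[ℂ] H} (hy : y ∈ Set.centralizer (Set.centralizer S))
    (f : lp (fun _ : ι => H) 2) : P (amplification y f) = amplification y (P f) := by
  classical
  have hs (v : H) (k : ι) : P (lp.single 2 k (y v)) = amplification y (P (lp.single 2 k v)) := by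
    ext l
    -- The matrix entries of an operator commuting with the diagonal action of `S` lie in the
    -- commutant of `S`, so `y` commutes with each of them.
    let Q : H →L[ℂ] H := (lp.evalCLM ℂ (fun _ : ι => H) 2 l) ∘L P ∘L
      (lp.singleContinuousLinearMap ℂ (fun _ : ι => H) 2 k)
    have hQ : Q ∈ Set.centralizer S := by
      intro a ha
      ext w
      change a (P (lp.single 2 k w) l) = P (lp.single 2 k (a w)) l
      rw [← amplification_single, hP a ha, amplification_apply]
    have := congrArg (fun T : H →L[ℂ] H => T v) (hy Q hQ)
    exact this
  have h := lp.hasSum_single (p := 2) (by simp) f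
  have h1 := (h.mapL (amplification y)).mapL P
  have h2 := (h.mapL P).mapL (amplification y)
  simp_rw [amplification_single, hs] at h1
  exact h1.unique h2

/-- Von Neumann's argument: the closure of `S f` is invariant under the self-adjoint algebra `S`, so
the projection onto it commutes with `S`, hence with `y`. It contains `f` because `1 ∈ S`, and
therefore contains `y f`. -/
theorem amplification_mem_closure [CompleteSpace H] (S : StarSubalgebra ℂ (H →L[ℂ] H))
    {y : H →L[ℂ] H} (hy : y ∈ Set.centralizer (Set.centralizer (S : Set (H →L[ℂ] H))))
    (f : lp (fun _ : ι => H) 2) :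
    amplification y f ∈ closure ((fun a => amplification a f) '' (S : Set (H →L[ℂ] H))) := by
  let L : (H →L[ℂ] H) →ₗ[ℂ] lp (fun _ : ι => H) 2 :=
    { toFun := fun a => amplification a f
      map_add' := fun a b => by ext k; simp
      map_smul' := fun c a => by ext k; simp }
  let V := (S.toSubalgebra.toSubmodule.map L).topologicalClosure
  have hV : (V : Set (lp (fun _ : ι => H) 2)) =
      closure ((fun a => amplification a f) '' (S : Set (H →L[ℂ] H))) := rfl
  have : CompleteSpace V := (Submodule.isClosed_topologicalClosure _).completeSpace_coe
  have hinv : ∀ a ∈ S, ∀ g ∈ V, amplification a g ∈ V := by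
    intro a ha g hg
    refine closure_minimal (s := (S.toSubalgebra.toSubmodule.map L : Set (lp (fun _ : ι => H) 2)))
      (t := amplification a ⁻¹' V) ?_ ?_ hg
    · rintro _ ⟨b, hb, rfl⟩
      exact subset_closure ⟨a * b, mul_mem (S := StarSubalgebra ℂ (H →L[ℂ] H)) ha hb, by
        ext k; rfl⟩
    · exact (Submodule.isClosed_topologicalClosure _).preimage (amplification a).continuous
  have hcomm : ∀ a ∈ (S : Set (H →L[ℂ] H)), ∀ g,
      V.starProjection (amplification a g) = amplification a (V.starProjection g) := by
    intro a ha g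
    refine Submodule.eq_starProjection_of_mem_of_inner_eq_zero
      (hinv a ha _ (V.starProjection_apply_mem g)) fun w hw => ?_
    rw [← map_sub, inner_amplification_left]
    exact V.starProjection_inner_eq_zero _ _ (hinv _ (star_mem ha) w hw)
  have hf : V.starProjection f = f := Submodule.starProjection_eq_self_iff.2 <|
    subset_closure ⟨1, one_mem S, by ext k; rfl⟩
  rw [← hV, SetLike.mem_coe, ← Submodule.starProjection_eq_self_iff,
    amplification_comm_of_mem_centralizer _ hcomm hy, hf]

end Amplification

/-! ### Density in the trace norm -/

section Density

variable {H : Type*} [NormedAddCommGroup H] [InnerProductSpace ℂ H] [CompleteSpace H]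

theorem lp_two_norm_sq {H : Type*} [NormedAddCommGroup H] {ι : Type*} (f : lp (fun _ : ι => H) 2) :
    HasSum (fun k => ‖f k‖ ^ 2) (‖f‖ ^ 2) := by
  simpa using lp.hasSum_norm (p := 2) (by simp) f

/-- A normal tracial state is continuous for a vector seminorm of an amplification. -/
theorem TracialVNA.exists_norm_toL2_le (M : TracialVNA H) :
    ∃ f : lp (fun _ : ℕ ⊕ ℕ => H) 2,
      ∀ x : M, ‖toL2 M.tr x‖ ≤ ‖amplification (x : H →L[ℂ] H) f‖ := by
  obtain ⟨ξ, η, hξ, hη, h⟩ := M.normal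
  have hs : Summable (fun k => ‖(Sum.elim ξ η : ℕ ⊕ ℕ → H) k‖ ^ 2) :=
    (Summable.sum (f := fun k => ‖(Sum.elim ξ η : ℕ ⊕ ℕ → H) k‖ ^ 2)
      (by simpa [Function.comp_def] using hξ) (by simpa [Function.comp_def] using hη))
  -- Both families enter because τ(x* x) = ∑ ⟨x ηₙ, x ξₙ⟩, which is at most ∑ (‖x ξₙ‖² + ‖x ηₙ‖²).
  refine ⟨⟨Sum.elim ξ η, memℓp_gen (by simpa using hs)⟩, fun x => ?_⟩
  refine le_of_sq_le_sq ?_ (norm_nonneg _)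
  have h1 := lp_two_norm_sq (amplification (x : H →L[ℂ] H)
    ⟨Sum.elim ξ η, memℓp_gen (by simpa using hs)⟩)
  have hl := h1.summable.comp_injective Sum.inl_injective
  have hr := h1.summable.comp_injective Sum.inr_injective
  have h2 := (hl.hasSum.sum hr.hasSum).unique h1
  rw [← h2, norm_toL2_sq, ← hl.tsum_add hr]
  refine (Complex.re_le_norm _).trans ?_
  rw [← (h (star x * x)).tsum_eq]
  refine tsum_of_norm_bounded (hl.add hr).hasSum fun k => ?_
  have e : ⟪η k, ((star x * x : M) : H →L[ℂ] H) (ξ k)⟫_ℂ =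
      ⟪(x : H →L[ℂ] H) (η k), (x : H →L[ℂ] H) (ξ k)⟫_ℂ := by
    rw [← ContinuousLinearMap.adjoint_inner_right]
    rfl
  rw [e]
  refine (norm_inner_le_norm _ _).trans ?_
  change _ ≤ ‖(x : H →L[ℂ] H) (ξ k)‖ ^ 2 + ‖(x : H →L[ℂ] H) (η k)‖ ^ 2
  nlinarith [sq_nonneg (‖(x : H →L[ℂ] H) (ξ k)‖ - ‖(x : H →L[ℂ] H) (η k)‖),
    sq_nonneg (‖(x : H →L[ℂ] H) (ξ k)‖ + ‖(x : H →L[ℂ] H) (η k)‖)]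

/-- A `*`-algebra whose double commutant contains `M` is dense in `M` for the trace norm. -/
theorem TracialVNA.exists_norm_toL2_sub_lt (M : TracialVNA H) (S : StarSubalgebra ℂ M)
    (hS : (M.alg : Set (H →L[ℂ] H)) ⊆
      Set.centralizer (Set.centralizer ((fun x : M => (x : H →L[ℂ] H)) '' (S : Set M))))
    (y : M) {ε : ℝ} (hε : 0 < ε) : ∃ a ∈ S, ‖toL2 M.tr (y - a)‖ < ε := by
  obtain ⟨f, hf⟩ := M.exists_norm_toL2_le
  have := amplification_mem_closure (S.map M.alg.toStarSubalgebra.subtype) (hS y.2) f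
  obtain ⟨_, ⟨_, ⟨a, ha, rfl⟩, rfl⟩, h⟩ := Metric.mem_closure_iff.1 this ε hε
  refine ⟨a, ha, (hf _).trans_lt ?_⟩
  rw [dist_eq_norm] at h
  have e : amplification ((y - a : M) : H →L[ℂ] H) f = amplification (y : H →L[ℂ] H) f -
      amplification (a : H →L[ℂ] H) f := by
    ext k
    rfl
  rwa [e]

end Density

/-! ### Weak operator limits of bounded sequences -/

section WeakLimits

variable {H : Type*} [NormedAddCommGroup H] [InnerProductSpace ℂ H] [CompleteSpace H]

theorem exists_tendsto_of_norm_le (ω : Ultrafilter ℕ) {f : ℕ → ℂ} {C : ℝ} (hf : ∀ n, ‖f n‖ ≤ C) :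
    ∃ c : ℂ, Tendsto f ω (𝓝 c) := by
  obtain ⟨c, -, hc⟩ := (isCompact_closedBall (0 : ℂ) C).ultrafilter_le_nhds (ω.map f) (by
    rw [Ultrafilter.coe_map, le_principal_iff, mem_map]
    exact Filter.univ_mem' fun n => mem_closedBall_zero_iff.2 (hf n))
  exact ⟨c, hc⟩

/-- A bounded sequence of operators has a limit along `ω` in the weak operator topology. -/
theorem exists_tendsto_inner (ω : Ultrafilter ℕ) {v : ℕ → H →L[ℂ] H} {C : ℝ}
    (hv : ∀ n, ‖v n‖ ≤ C) : ∃ e : H →L[ℂ] H, ‖e‖ ≤ C ∧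
      ∀ ξ η : H, Tendsto (fun n => ⟪v n ξ, η⟫_ℂ) ω (𝓝 ⟪e ξ, η⟫_ℂ) := by
  have bound (ξ η : H) (n : ℕ) : ‖⟪v n ξ, η⟫_ℂ‖ ≤ C * ‖ξ‖ * ‖η‖ :=
    (norm_inner_le_norm _ _).trans (mul_le_mul_of_nonneg_right
      ((v n).le_of_opNorm_le (hv n) ξ) (norm_nonneg _))
  have ex (ξ η : H) := exists_tendsto_of_norm_le ω (bound ξ η)
  choose b hb using ex
  have hbC (ξ η : H) : ‖b ξ η‖ ≤ C * ‖ξ‖ * ‖η‖ :=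
    le_of_tendsto (hb ξ η).norm (Eventually.of_forall (bound ξ η))
  have hC : 0 ≤ C := (norm_nonneg _).trans (hv 0)
  let L : H →ₗ⋆[ℂ] H →ₗ[ℂ] ℂ := LinearMap.mk₂'ₛₗ (starRingEnd ℂ) (RingHom.id ℂ) b
    (fun ξ ξ' η => tendsto_nhds_unique (hb _ _) (((hb ξ η).add (hb ξ' η)).congr fun n => by
      simp))
    (fun c ξ η => tendsto_nhds_unique (hb _ _) (((hb ξ η).const_mul (conj c)).congr fun n => by
      simp [mul_comm]))
    (fun ξ η η' => tendsto_nhds_unique (hb _ _) (((hb ξ η).add (hb ξ η')).congr fun n => by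
      simp))
    (fun c ξ η => tendsto_nhds_unique (hb _ _) (((hb ξ η).const_mul c).congr fun n => by
      simp))
  let T : H →L⋆[ℂ] H →L[ℂ] ℂ := L.mkContinuous₂ C hbC
  have hT (ξ η : H) : ⟪InnerProductSpace.continuousLinearMapOfBilin T ξ, η⟫_ℂ = b ξ η :=
    InnerProductSpace.continuousLinearMapOfBilin_apply T ξ η
  refine ⟨InnerProductSpace.continuousLinearMapOfBilin T, ?_, fun ξ η => by
    rw [hT]; exact hb ξ η⟩
  refine ContinuousLinearMap.opNorm_le_bound _ hC fun ξ => ?_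
  by_cases h0 : InnerProductSpace.continuousLinearMapOfBilin T ξ = 0
  · rw [h0, norm_zero]; positivity
  · have h1 := hbC ξ (InnerProductSpace.continuousLinearMapOfBilin T ξ)
    rw [← hT, inner_self_eq_norm_sq_to_K, norm_pow, RCLike.norm_ofReal, abs_norm, pow_two] at h1
    exact le_of_mul_le_mul_right h1 (norm_pos_iff.2 h0)

/-- Balls of `M` are compact for the topology of the functionals `τ(c ·)`. -/
theorem TracialVNA.exists_tendsto_tr_mul (M : TracialVNA H) (ω : Ultrafilter ℕ) {v : ℕ → M}
    {C : ℝ} (hv : ∀ n, ‖v n‖ ≤ C) :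
    ∃ e : M, ‖e‖ ≤ C ∧ ∀ c : M, Tendsto (fun n => M.tr (c * v n)) ω (𝓝 (M.tr (c * e))) := by
  obtain ⟨e, he, hlim⟩ := exists_tendsto_inner ω (v := fun n => (v n : H →L[ℂ] H)) hv
  have hmem : e ∈ M.alg.toStarSubalgebra := by
    -- Commuting with a fixed operator survives weak limits, so the limit stays in the double
    -- commutant.
    have : e ∈ Set.centralizer (Set.centralizer (M.alg : Set (H →L[ℂ] H))) := by
      intro m hm
      ext1 ξ
      refine ext_inner_right ℂ fun η => ?_
      change ⟪m (e ξ), η⟫_ℂ = ⟪e (m ξ), η⟫_ℂ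
      rw [← ContinuousLinearMap.adjoint_inner_right]
      refine tendsto_nhds_unique (hlim _ _) ((hlim (m ξ) η).congr fun n => ?_)
      rw [ContinuousLinearMap.adjoint_inner_right]
      have := congrArg (fun T : H →L[ℂ] H => T ξ) (hm (v n) (v n).2)
      exact congrArg (fun ζ => ⟪ζ, η⟫_ℂ) this
    rw [M.alg.centralizer_centralizer] at this
    exact this
  refine ⟨⟨e, hmem⟩, he, fun c => ?_⟩
  obtain ⟨ξ, η, hξ, hη, h⟩ := M.normal
  simp_rw [← (h _).tsum_eq]
  have hC : 0 ≤ C := (norm_nonneg _).trans (hv 0)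
  have inner_eq (x : H →L[ℂ] H) (k : ℕ) : ⟪η k, (c : H →L[ℂ] H) (x (ξ k))⟫_ℂ =
      conj ⟪x (ξ k), star (c : H →L[ℂ] H) (η k)⟫_ℂ := by
    rw [inner_conj_symm, ContinuousLinearMap.star_eq_adjoint,
      ContinuousLinearMap.adjoint_inner_left]
  -- Normality writes the trace as a series of matrix coefficients; each converges weakly, and
  -- square summability of ξ and η dominates them uniformly in `n`.
  refine tendsto_tsum_of_dominated_convergence
    (bound := fun k => ‖(c : H →L[ℂ] H)‖ * C * (‖ξ k‖ ^ 2 + ‖η k‖ ^ 2))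
    ((hξ.add hη).mul_left _) (fun k => ?_) (Eventually.of_forall fun n k => ?_)
  · change Tendsto (fun n => ⟪η k, (c : H →L[ℂ] H) ((v n : H →L[ℂ] H) (ξ k))⟫_ℂ) ω
      (𝓝 ⟪η k, (c : H →L[ℂ] H) (e (ξ k))⟫_ℂ)
    simp_rw [inner_eq]
    exact (Complex.continuous_conj.tendsto _).comp (hlim _ _)
  · refine (norm_inner_le_norm _ _).trans ?_
    change ‖η k‖ * ‖(c : H →L[ℂ] H) ((v n : H →L[ℂ] H) (ξ k))‖ ≤ _
    have h1 : ‖(c : H →L[ℂ] H) ((v n : H →L[ℂ] H) (ξ k))‖ ≤ ‖(c : H →L[ℂ] H)‖ * (C * ‖ξ k‖) :=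
      (ContinuousLinearMap.le_opNorm _ _).trans (mul_le_mul_of_nonneg_left
        (ContinuousLinearMap.le_of_opNorm_le _ (hv n) _) (norm_nonneg _))
    have h2 : ‖η k‖ * ‖ξ k‖ ≤ ‖ξ k‖ ^ 2 + ‖η k‖ ^ 2 := by
      nlinarith [sq_nonneg (‖ξ k‖ - ‖η k‖), sq_nonneg (‖ξ k‖ + ‖η k‖)]
    calc _ ≤ ‖η k‖ * (‖(c : H →L[ℂ] H)‖ * (C * ‖ξ k‖)) := by gcongr
      _ = ‖(c : H →L[ℂ] H)‖ * C * (‖η k‖ * ‖ξ k‖) := by ring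
      _ ≤ _ := by gcongr

end WeakLimits

/-! ### Truncation -/

section Truncation

/-- Functional calculus of z* z with m = max(C, √t): take g = C / m, p = √(m - C), q = p / m, so
that |z g| = min(|z|, C). The identities record what the trace estimates for `z - z * g` need,
without further functional calculus. -/
theorem exists_truncation {A : Type*} [CStarAlgebra A] (z : A) {C : ℝ} (hC : 0 < C) :
    ∃ g p q : A, ‖z * g‖ ≤ C ∧ star p = p ∧ star q = q ∧ 1 - g = q * p ∧
      q * p = p * q ∧ q * p * (star z * z) * g = (C : ℂ) • (p * p) ∧
      q * (star z * z) * q = p * p := by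
  set a := star z * z with ha
  have hsa : IsSelfAdjoint a := .star_mul_self z
  have hspec : ∀ t ∈ spectrum ℝ a, 0 ≤ t := fun t ht => spectrum_star_mul_self_nonneg t ht
  let m : ℝ → ℝ := fun t => max C (√t)
  have hm : Continuous m := continuous_const.max Real.continuous_sqrt
  have hm0 (t) : m t ≠ 0 := (hC.trans_le (le_max_left _ _)).ne'
  have hmC (t) : 0 ≤ m t - C := sub_nonneg.2 (le_max_left _ _)
  let g : ℝ → ℝ := fun t => C / m t
  let p : ℝ → ℝ := fun t => √(m t - C)
  let q : ℝ → ℝ := fun t => p t / m t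
  have hg : Continuous g := continuous_const.div hm hm0
  have hp : Continuous p := (hm.sub continuous_const).sqrt
  have hq : Continuous q := hp.div hm hm0
  have hpp (t) : p t * p t = m t - C := Real.mul_self_sqrt (hmC t)
  -- The factor m - C vanishes below the cutoff, and above it t = m².
  have htm {t : ℝ} (ht : 0 ≤ t) : (m t - C) * t = (m t - C) * (m t * m t) := by
    rcases le_total C (√t) with h | h
    · have : m t = √t := max_eq_right h
      rw [this, Real.mul_self_sqrt ht]
    · have : m t = C := max_eq_left h
      rw [this]; ring
  have hid : cfc (fun t : ℝ => t) a = a := cfc_id' ℝ a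
  have one_eq : (1 : A) = cfc (fun _ : ℝ => (1 : ℝ)) a := (cfc_const_one ℝ a).symm
  have mul_f {f h : ℝ → ℝ} (hf : Continuous f) (hh : Continuous h) :
      cfc f a * cfc h a = cfc (fun t => f t * h t) a :=
    (cfc_mul f h a hf.continuousOn hh.continuousOn).symm
  have hgt : Continuous fun t => g t * t := hg.mul continuous_id'
  have hqt : Continuous fun t => q t * t := hq.mul continuous_id'
  have hqp : Continuous fun t => q t * p t := hq.mul hp
  have hqpt : Continuous fun t => q t * p t * t := hqp.mul continuous_id'
  have hp2 : Continuous fun t => p t * p t := hp.mul hp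
  have mul_a {f : ℝ → ℝ} (hf : Continuous f) : cfc f a * a = cfc (fun t => f t * t) a := by
    rw [cfc_mul f (fun t => t) a (by fun_prop) (by fun_prop), hid]
  have hgn : star (z * cfc g a) * (z * cfc g a) = cfc (fun t => g t * t * g t) a := by
    rw [star_mul, (cfc_predicate g a : IsSelfAdjoint (cfc g a)).star_eq, mul_assoc,
      ← mul_assoc (star z), ← ha, ← mul_assoc, mul_a hg, mul_f hgt hg]
  refine ⟨cfc g a, cfc p a, cfc q a, ?_, cfc_predicate p a, cfc_predicate q a,
    ?_, ?_, ?_, ?_⟩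
  · refine le_of_sq_le_sq ?_ hC.le
    rw [pow_two, ← CStarRing.norm_star_mul_self, hgn]
    refine norm_cfc_le (by positivity) fun t ht => ?_
    have ht0 := hspec t ht
    have h1 : t ≤ m t * m t := by
      conv_lhs => rw [← Real.mul_self_sqrt ht0]
      exact mul_self_le_mul_self (Real.sqrt_nonneg _) (le_max_right _ _)
    have h2 : g t * t * g t = C ^ 2 * (t / (m t * m t)) := by
      change C / m t * t * (C / m t) = _
      have := hm0 t
      field_simp
    rw [h2, Real.norm_of_nonneg (by have := mul_self_nonneg (m t); positivity)]
    refine mul_le_of_le_one_right (by positivity) (div_le_one_of_le₀ h1 (mul_self_nonneg _))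
  · rw [one_eq, ← cfc_sub _ _ a continuousOn_const hg.continuousOn, mul_f hq hp]
    refine cfc_congr fun t _ => ?_
    have := hm0 t
    change 1 - C / m t = p t / m t * p t
    rw [div_mul_eq_mul_div, hpp]
    field_simp
  · rw [mul_f hq hp, mul_f hp hq]
    exact cfc_congr fun t _ => mul_comm _ _
  · have h : ((C : ℂ) • (cfc p a * cfc p a) : A) = cfc (fun t => C * (p t * p t)) a := by
      rw [cfc_const_mul C _ a hp2.continuousOn, mul_f hp hp, Complex.coe_smul]
    rw [h, mul_f hq hp, mul_a hqp, mul_f hqpt hg]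
    refine cfc_congr fun t ht => ?_
    have := hm0 t
    change p t / m t * p t * t * (C / m t) = C * (p t * p t)
    rw [div_mul_eq_mul_div, hpp]
    have h3 := htm (hspec t ht)
    field_simp
    linear_combination h3
  · rw [mul_a hq, mul_f hqt hq, mul_f hp hp]
    refine cfc_congr fun t ht => ?_
    have := hm0 t
    change p t / m t * t * (p t / m t) = p t * p t
    have h3 := htm (hspec t ht)
    have h4 : p t / m t * t * (p t / m t) = (p t * p t) * t / (m t * m t) := by field_simp
    rw [h4, hpp, h3]
    field_simp

end Truncation

/-! ### Conditional expectations -/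

theorem norm_starAlgHom_apply_le {A B : Type*} [CStarAlgebra A] [CStarAlgebra B]
    (φ : A →⋆ₐ[ℂ] B) (x : A) : ‖φ x‖ ≤ ‖x‖ :=
  NonUnitalStarAlgHom.norm_apply_le φ x

theorem norm_le_norm_add_of_re_inner_nonneg {E : Type*} [SeminormedAddCommGroup E]
    [InnerProductSpace ℂ E] {a b : E} (h : 0 ≤ (⟪a, b⟫_ℂ).re) : ‖b‖ ≤ ‖a + b‖ := by
  refine le_of_sq_le_sq ?_ (norm_nonneg _)
  have h1 := norm_add_sq (𝕜 := ℂ) a b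
  have h' : 0 ≤ RCLike.re ⟪a, b⟫_ℂ := h
  nlinarith [sq_nonneg ‖a‖]

section CondExp

variable {HB HN : Type*} [NormedAddCommGroup HB] [InnerProductSpace ℂ HB] [CompleteSpace HB]
  [NormedAddCommGroup HN] [InnerProductSpace ℂ HN] [CompleteSpace HN]
  {B : TracialVNA HB} {N : TracialVNA HN} (i : Inclusion B N)

theorem Inclusion.map_mul (x y : B) : i (x * y) = i x * i y := _root_.map_mul i.toStarAlgHom x y

theorem Inclusion.map_star (x : B) : i (star x) = star (i x) :=
  StarHomClass.map_star i.toStarAlgHom x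

theorem Inclusion.map_sub (x y : B) : i (x - y) = i x - i y := _root_.map_sub i.toStarAlgHom x y

theorem Inclusion.map_one : i 1 = 1 := _root_.map_one i.toStarAlgHom

theorem Inclusion.norm_toL2 (x : B) : ‖toL2 N.tr (i x)‖ = ‖toL2 B.tr x‖ := by
  rw [← sq_eq_sq₀ (norm_nonneg _) (norm_nonneg _), norm_toL2_sq, norm_toL2_sq, ← i.map_star,
    ← i.map_mul, i.tr_map]

theorem Inclusion.norm_le (x : B) : ‖i x‖ ≤ ‖x‖ :=
  @norm_starAlgHom_apply_le B N (StarSubalgebra.cstarAlgebra _ (h_closed := B.isClosed))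
    (StarSubalgebra.cstarAlgebra _ (h_closed := N.isClosed)) i.toStarAlgHom x

theorem TracialVNA.exists_truncation (B : TracialVNA HB) (z : B) {C : ℝ} (hC : 0 < C) :
    ∃ g p q : B, ‖z * g‖ ≤ C ∧ star p = p ∧ star q = q ∧ 1 - g = q * p ∧
      q * p = p * q ∧ q * p * (star z * z) * g = (C : ℂ) • (p * p) ∧
      q * (star z * z) * q = p * p :=
  @TracialVN.exists_truncation B (StarSubalgebra.cstarAlgebra _ (h_closed := B.isClosed)) z C hC

/-- Truncation at height `C` brings elements of `B` closer to any `x` with `‖x‖ ≤ C`. -/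
theorem Inclusion.exists_norm_le_inner_nonneg (x : N) {C : ℝ} (hC : 0 < C) (hx : ‖x‖ ≤ C) (z : B) :
    ∃ v : B, ‖v‖ ≤ C ∧
      0 ≤ (⟪toL2 N.tr (i z) - toL2 N.tr (i v), toL2 N.tr (i v) - toL2 N.tr x⟫_ℂ).re := by
  obtain ⟨g, p, q, hg, hsp, hsq, h1, hqp, h2, h3⟩ := B.exists_truncation z hC
  -- As z - z g = z q p, its inner product with z g equals C ‖p‖₂², while ⟨z q p, x⟩ = ⟨z q, x p⟩
  -- has real part at most ‖z q‖₂ ‖x‖ ‖p‖₂ ≤ C ‖p‖₂².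
  refine ⟨z * g, hg, ?_⟩
  have e1 : z - z * g = z * (q * p) := by rw [← h1, mul_sub, mul_one]
  have hp : ‖toL2 N.tr (i p)‖ ^ 2 = (B.tr (p * p)).re := by
    rw [i.norm_toL2, norm_toL2_sq, hsp]
  have hzq : ‖toL2 N.tr (i (z * q))‖ = ‖toL2 N.tr (i p)‖ := by
    rw [← sq_eq_sq₀ (norm_nonneg _) (norm_nonneg _), hp, i.norm_toL2, norm_toL2_sq, star_mul, hsq,
      ← h3]
    simp only [mul_assoc]
  have e2 : (⟪toL2 N.tr (i (z * (q * p))), toL2 N.tr (i (z * g))⟫_ℂ).re =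
      C * ‖toL2 N.tr (i p)‖ ^ 2 := by
    rw [inner_toL2, ← i.map_star, ← i.map_mul, i.tr_map, hp, star_mul, star_mul, hsp, hsq, ← hqp,
      ← mul_assoc, mul_assoc (q * p), h2, LinearMap.map_smul, smul_eq_mul, Complex.re_ofReal_mul]
  have e3 : ⟪toL2 N.tr (i (z * (q * p))), toL2 N.tr x⟫_ℂ =
      ⟪toL2 N.tr (i (z * q)), toL2 N.tr (x * i p)⟫_ℂ := by
    rw [inner_toL2, inner_toL2, ← mul_assoc, i.map_mul (z * q), star_mul, ← i.map_star p, hsp,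
      mul_assoc, N.tr_mul_comm, mul_assoc]
  have h4 : (⟪toL2 N.tr (i (z * (q * p))), toL2 N.tr x⟫_ℂ).re ≤ C * ‖toL2 N.tr (i p)‖ ^ 2 := by
    rw [e3]
    refine (Complex.re_le_norm _).trans ((norm_inner_le_norm _ _).trans ?_)
    rw [hzq, pow_two, mul_left_comm]
    gcongr
    exact (N.norm_toL2_mul_le _ _).trans (by gcongr)
  rw [← LinearMap.map_sub, ← i.map_sub, e1, inner_sub_right, Complex.sub_re, e2]
  linarith

/-- The trace-preserving conditional expectation of `N` onto `B` exists and is contractive. -/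
theorem Inclusion.exists_isCondExp (x : N) : ∃ e : B, ‖e‖ ≤ ‖x‖ ∧ i.IsCondExp x e := by
  rcases (norm_nonneg x).eq_or_lt with h0 | hC
  · refine ⟨0, by simp, fun b => ?_⟩
    rw [norm_eq_zero.1 h0.symm]
    simp
  let L : B →ₗ[ℂ] L2 N.tr := toL2 N.tr ∘ₗ i.toStarAlgHom.toAlgHom.toLinearMap
  let V := (LinearMap.range L).topologicalClosure
  have hL (b : B) : toL2 N.tr (i b) ∈ V := subset_closure ⟨b, rfl⟩
  have : CompleteSpace V := (Submodule.isClosed_topologicalClosure _).completeSpace_coe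
  -- The expectation is at first only a vector of L²; it must be shown to come from an element of B
  -- of norm at most ‖x‖.
  set ζ := V.starProjection (toL2 N.tr x) with hζ
  have hζV : ζ ∈ V := V.starProjection_apply_mem _
  have hperp (w) (hw : w ∈ V) : ⟪w, toL2 N.tr x⟫_ℂ = ⟪w, ζ⟫_ℂ := by
    have := V.starProjection_inner_eq_zero (toL2 N.tr x) w hw
    rw [← sub_eq_zero, ← inner_sub_right, ← inner_conj_symm, this, _root_.map_zero]
  have hex (n : ℕ) : ∃ v : B, ‖v‖ ≤ ‖x‖ ∧ ‖toL2 N.tr (i v) - ζ‖ ≤ 1 / ((n : ℝ) + 1) := by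
    obtain ⟨_, ⟨z, rfl⟩, hz⟩ := Metric.mem_closure_iff.1
      (show ζ ∈ closure (LinearMap.range L : Set (L2 N.tr)) from hζV) (1 / ((n : ℝ) + 1))
      Nat.one_div_pos_of_nat
    obtain ⟨v, hv, h⟩ := i.exists_norm_le_inner_nonneg x hC le_rfl z
    refine ⟨v, hv, le_trans ?_ hz.le⟩
    -- Differences of elements of B do not distinguish x from its projection ζ, so truncating z at
    -- height ‖x‖ does not move it away from ζ.
    rw [inner_sub_right, hperp _ (V.sub_mem (hL z) (hL v)), ← inner_sub_right] at h
    have hzv : L z - ζ = (toL2 N.tr (i z) - toL2 N.tr (i v)) + (toL2 N.tr (i v) - ζ) := by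
      rw [sub_add_sub_cancel]
      rfl
    rw [dist_comm, dist_eq_norm]
    rw [hzv]
    exact norm_le_norm_add_of_re_inner_nonneg h
  choose v hv hvζ using hex
  have hlim : Tendsto (fun n => toL2 N.tr (i (v n))) atTop (𝓝 ζ) :=
    tendsto_iff_norm_sub_tendsto_zero.2
      (squeeze_zero (fun _ => norm_nonneg _) hvζ tendsto_one_div_add_atTop_nhds_zero_nat)
  -- Compactness of balls yields an actual element of B; it represents ζ because both limits give
  -- the same functionals τ(b ·).
  obtain ⟨e, he, hlim_e⟩ := B.exists_tendsto_tr_mul (hyperfilter ℕ) hv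
  refine ⟨e, he, fun b => ?_⟩
  refine tendsto_nhds_unique ?_ (hlim_e b)
  have h1 : Tendsto (fun n => ⟪toL2 N.tr (i (star b)), toL2 N.tr (i (v n))⟫_ℂ) atTop
      (𝓝 ⟪toL2 N.tr (i (star b)), ζ⟫_ℂ) := tendsto_const_nhds.inner hlim
  rw [← hperp _ (hL _), inner_toL2, i.map_star, star_star] at h1
  refine (h1.mono_left ?_).congr fun n => ?_
  · rw [← Nat.cofinite_eq_atTop]
    exact hyperfilter_le_cofinite
  · rw [inner_toL2, star_star, ← i.map_mul, i.tr_map]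

theorem Inclusion.IsCondExp.sub_mem_ominus {x : N} {e : B} (h : i.IsCondExp x e) :
    x - i e ∈ ominus N.tr (Set.range i) := by
  rintro _ ⟨b, rfl⟩
  rw [inner_toL2, ← i.map_star, mul_sub, LinearMap.map_sub, h, ← i.map_mul, i.tr_map, sub_self]

end CondExp

/-! ### Linearity of the inner product of `L²(A, τ)` -/

section Linearity

variable {A : Type*} [Ring A] [StarRing A] [Algebra ℂ A] [StarModule ℂ A] (τ : PosFunctional A)

theorem inner_toL2_add_left (x y z : A) :
    ⟪toL2 τ (x + y), toL2 τ z⟫_ℂ = ⟪toL2 τ x, toL2 τ z⟫_ℂ + ⟪toL2 τ y, toL2 τ z⟫_ℂ := by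
  rw [map_add, inner_add_left]

theorem inner_toL2_add_right (x y z : A) :
    ⟪toL2 τ x, toL2 τ (y + z)⟫_ℂ = ⟪toL2 τ x, toL2 τ y⟫_ℂ + ⟪toL2 τ x, toL2 τ z⟫_ℂ := by
  rw [map_add, inner_add_right]

theorem inner_toL2_sub_left (x y z : A) :
    ⟪toL2 τ (x - y), toL2 τ z⟫_ℂ = ⟪toL2 τ x, toL2 τ z⟫_ℂ - ⟪toL2 τ y, toL2 τ z⟫_ℂ := by
  rw [map_sub, inner_sub_left]

theorem inner_toL2_sub_right (x y z : A) :
    ⟪toL2 τ x, toL2 τ (y - z)⟫_ℂ = ⟪toL2 τ x, toL2 τ y⟫_ℂ - ⟪toL2 τ x, toL2 τ z⟫_ℂ := by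
  rw [map_sub, inner_sub_right]

theorem norm_toL2_add_le (x y : A) : ‖toL2 τ (x + y)‖ ≤ ‖toL2 τ x‖ + ‖toL2 τ y‖ := by
  rw [map_add]
  exact norm_add_le _ _

theorem norm_toL2_sub_le (x y : A) : ‖toL2 τ (x - y)‖ ≤ ‖toL2 τ x‖ + ‖toL2 τ y‖ := by
  rw [map_sub]
  exact norm_sub_le _ _

end Linearity

/-! ### Alternating products -/

section Alternating

variable {A : Type*} [Ring A] [Algebra ℂ A]

/-- The span of the alternating products `P₂ P₁ P₂ ⋯ P₁ P₂` with `n` factors `P₁`. -/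
def altProd (P₁ P₂ : Submodule ℂ A) : ℕ → Submodule ℂ A
  | 0 => P₂
  | n + 1 => P₂ * (P₁ * altProd P₁ P₂ n)

/-- The span of all alternating products that begin and end with a factor in `P₂`. -/
def altSpan (P₁ P₂ : Submodule ℂ A) : Submodule ℂ A := ⨆ n, altProd P₁ P₂ n

theorem altProd_mul_altProd_le (P₁ P₂ : Submodule ℂ A) (m n : ℕ) :
    altProd P₁ P₂ n * (P₁ * altProd P₁ P₂ m) ≤ altProd P₁ P₂ (n + m + 1) := by
  induction n with
  | zero => rw [zero_add]; exact le_rfl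
  | succ n ih =>
    have : n + 1 + m + 1 = (n + m + 1) + 1 := by ring
    rw [this, altProd, altProd, mul_assoc, mul_assoc]
    gcongr

/-- A letter of P₁ between two words that begin and end in P₂ leaves nothing to contract. This is
the one multiplication rule behind all the orthogonality relations. -/
theorem altSpan_mul_altSpan_le (P₁ P₂ : Submodule ℂ A) :
    altSpan P₁ P₂ * (P₁ * altSpan P₁ P₂) ≤ altSpan P₁ P₂ := by
  simp only [altSpan, Submodule.mul_iSup, Submodule.iSup_mul, iSup_le_iff]
  exact fun m n => (altProd_mul_altProd_le P₁ P₂ _ _).trans (le_iSup (altProd P₁ P₂) _)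

theorem le_altSpan (P₁ P₂ : Submodule ℂ A) : P₂ ≤ altSpan P₁ P₂ := le_iSup (altProd P₁ P₂) 0

section

variable {B₀ P₁ P₂ : Submodule ℂ A}

local notation "𝒩" => B₀ ⊔ P₁
local notation "𝒲" => altSpan P₁ P₂

theorem mul_left_mul_le : (𝒩 * 𝒲) * (P₁ * (𝒲 * 𝒩)) ≤ 𝒩 * (𝒲 * 𝒩) :=
  calc (𝒩 * 𝒲) * (P₁ * (𝒲 * 𝒩)) = 𝒩 * ((𝒲 * (P₁ * 𝒲)) * 𝒩) := by simp only [mul_assoc]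
    _ ≤ 𝒩 * (𝒲 * 𝒩) := by gcongr; exact altSpan_mul_altSpan_le _ _

theorem left_alt_left_mul_le : (P₁ * (𝒲 * P₁)) * (𝒲 * 𝒩) ≤ P₁ * (𝒲 * 𝒩) := by
  have e : (P₁ * (𝒲 * P₁)) * (𝒲 * 𝒩) = P₁ * ((𝒲 * (P₁ * 𝒲)) * 𝒩) := by simp only [mul_assoc]
  rw [e]
  gcongr
  exact altSpan_mul_altSpan_le _ _

theorem alt_mul_left_alt_left_le : 𝒲 * (P₁ * (𝒲 * P₁)) ≤ 𝒲 * 𝒩 := by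
  have e : 𝒲 * (P₁ * (𝒲 * P₁)) = (𝒲 * (P₁ * 𝒲)) * P₁ := by simp only [mul_assoc]
  rw [e]
  exact mul_le_mul' (altSpan_mul_altSpan_le _ _) le_sup_right

end

variable [StarRing A]

/-- The relations between `B` and the letters `P₁ = N₁ ⊖ B`, `P₂ = N₂ ⊖ B` of an amalgamated free
product, with respect to a trace. -/
structure IsFreeSplitting (τ : PosFunctional A) (B₀ P₁ P₂ : Submodule ℂ A) : Prop where
  trace : ∀ x y, τ (x * y) = τ (y * x)
  one_mem : 1 ∈ B₀
  star_base : ∀ x ∈ B₀, star x ∈ B₀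
  star_left : ∀ x ∈ P₁, star x ∈ P₁
  star_right : ∀ x ∈ P₂, star x ∈ P₂
  base_mul_base : B₀ * B₀ ≤ B₀
  base_mul_left : B₀ * P₁ ≤ P₁
  base_mul_right : B₀ * P₂ ≤ P₂
  left_mul_base : P₁ * B₀ ≤ P₁
  right_mul_base : P₂ * B₀ ≤ P₂
  left_mul_left : P₁ * P₁ ≤ B₀ ⊔ P₁
  right_mul_right : P₂ * P₂ ≤ B₀ ⊔ P₂
  -- Only words ending in P₂ are needed: the trace property brings a final factor from B₀ ⊔ P₁ to
  -- the front.
  free : ∀ n, ∀ x ∈ B₀ ⊔ P₁, ∀ w ∈ altProd P₁ P₂ n, τ (x * w) = 0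

namespace IsFreeSplitting

variable {τ : PosFunctional A} {B₀ P₁ P₂ : Submodule ℂ A}

local notation "𝒩" => B₀ ⊔ P₁
local notation "𝒲" => altSpan P₁ P₂

theorem one_mem_sup (h : IsFreeSplitting τ B₀ P₁ P₂) : 1 ∈ 𝒩 := Submodule.mem_sup_left h.one_mem

theorem le_mul_sup (h : IsFreeSplitting τ B₀ P₁ P₂)
    (S : Submodule ℂ A) : S ≤ S * 𝒩 := fun x hx => by
  simpa using Submodule.mul_mem_mul hx h.one_mem_sup

theorem le_sup_mul (h : IsFreeSplitting τ B₀ P₁ P₂)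
    (S : Submodule ℂ A) : S ≤ 𝒩 * S := fun x hx => by
  simpa using Submodule.mul_mem_mul h.one_mem_sup hx

theorem sup_mul_sup (h : IsFreeSplitting τ B₀ P₁ P₂) : 𝒩 * 𝒩 ≤ 𝒩 := by
  rw [Submodule.sup_mul, Submodule.mul_sup, Submodule.mul_sup]
  exact sup_le (sup_le (h.base_mul_base.trans le_sup_left) (h.base_mul_left.trans le_sup_right))
    (sup_le (h.left_mul_base.trans le_sup_right) h.left_mul_left)

theorem base_mul_alt (h : IsFreeSplitting τ B₀ P₁ P₂) : B₀ * 𝒲 ≤ 𝒲 := by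
  rw [altSpan, Submodule.mul_iSup]
  refine iSup_mono fun n => ?_
  cases n with
  | zero => exact h.base_mul_right
  | succ n => rw [altProd, ← mul_assoc]; exact mul_le_mul_left h.base_mul_right _

theorem alt_mul_base (h : IsFreeSplitting τ B₀ P₁ P₂) : 𝒲 * B₀ ≤ 𝒲 := by
  rw [altSpan, Submodule.iSup_mul]
  refine iSup_mono fun n => ?_
  induction n with
  | zero => exact h.right_mul_base
  | succ n ih => rw [altProd, mul_assoc, mul_assoc]; gcongr

theorem star_sup (h : IsFreeSplitting τ B₀ P₁ P₂) {x : A} (hx : x ∈ 𝒩) : star x ∈ 𝒩 := by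
  obtain ⟨b, hb, a, ha, rfl⟩ := Submodule.mem_sup.1 hx
  rw [star_add]
  exact Submodule.add_mem_sup (h.star_base _ hb) (h.star_left _ ha)

theorem star_mem_mul {S T S' T' : Submodule ℂ A} (hS : ∀ x ∈ S, star x ∈ S')
    (hT : ∀ x ∈ T, star x ∈ T') {x : A} (hx : x ∈ S * T) : star x ∈ T' * S' := by
  induction hx using Submodule.mul_induction_on' with
  | mem_mul_mem s hs t ht =>
    rw [star_mul]
    exact Submodule.mul_mem_mul (hT t ht) (hS s hs)
  | add x _ y _ hx hy => rw [star_add]; exact add_mem hx hy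

theorem star_alt (h : IsFreeSplitting τ B₀ P₁ P₂) {x : A} (hx : x ∈ 𝒲) : star x ∈ 𝒲 := by
  have key (n : ℕ) : ∀ x ∈ altProd P₁ P₂ n, star x ∈ altProd P₁ P₂ n := by
    induction n with
    | zero => exact h.star_right
    | succ n ih =>
      intro x hx
      have := star_mem_mul h.star_right (fun y hy => star_mem_mul h.star_left ih hy) hx
      rw [mul_assoc] at this
      -- The involution moves the recursion to the right end of the word; appending the one-letter
      -- word (index 0) restores it.
      exact altProd_mul_altProd_le P₁ P₂ 0 n this
  induction hx using Submodule.iSup_induction' with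
  | mem n x hx => exact le_iSup (altProd P₁ P₂) n (key n x hx)
  | zero => rw [star_zero]; exact zero_mem _
  | add x y _ _ hx hy => rw [star_add]; exact add_mem hx hy

theorem trace_sup_mul_alt (h : IsFreeSplitting τ B₀ P₁ P₂)
    {x w : A} (hx : x ∈ 𝒩) (hw : w ∈ 𝒲) : τ (x * w) = 0 := by
  induction hw using Submodule.iSup_induction' with
  | mem n w hw => exact h.free n x hx w hw
  | zero => rw [mul_zero, map_zero]
  | add v w _ _ hv hw => rw [mul_add, map_add, hv, hw, add_zero]

/-- Rotating the right factor to the front merges it with the left one. Each orthogonality relation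
below amounts to placing a product in this space. -/
theorem trace_eq_zero (h : IsFreeSplitting τ B₀ P₁ P₂)
    {x : A} (hx : x ∈ 𝒩 * (𝒲 * 𝒩)) : τ x = 0 := by
  have key : ∀ n ∈ 𝒩, ∀ y ∈ 𝒲 * 𝒩, τ (n * y) = 0 := fun n hn y hy => by
    induction hy using Submodule.mul_induction_on' with
    | mem_mul_mem w hw m hm =>
      rw [← mul_assoc, h.trace, ← mul_assoc]
      exact h.trace_sup_mul_alt (h.sup_mul_sup (Submodule.mul_mem_mul hm hn)) hw
    | add x _ y _ hx hy => rw [mul_add, map_add, hx, hy, add_zero]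
  induction hx using Submodule.mul_induction_on' with
  | mem_mul_mem n hn y hy => exact key n hn y hy
  | add x _ y _ hx hy => rw [map_add, hx, hy, add_zero]

theorem star_alt_sup (h : IsFreeSplitting τ B₀ P₁ P₂) {x : A} (hx : x ∈ 𝒲 * 𝒩) : star x ∈ 𝒩 * 𝒲 :=
  star_mem_mul (fun _ => h.star_alt) (fun _ => h.star_sup) hx

theorem star_sup_alt (h : IsFreeSplitting τ B₀ P₁ P₂) {x : A} (hx : x ∈ 𝒩 * 𝒲) : star x ∈ 𝒲 * 𝒩 :=
  star_mem_mul (fun _ => h.star_sup) (fun _ => h.star_alt) hx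

theorem inner_sup_eq_zero [StarModule ℂ A] (h : IsFreeSplitting τ B₀ P₁ P₂)
    {n t : A} (hn : n ∈ 𝒩) (ht : t ∈ 𝒩 * (𝒲 * 𝒩)) :
    ⟪toL2 τ n, toL2 τ t⟫_ℂ = 0 := by
  rw [inner_toL2]
  refine h.trace_eq_zero ?_
  have := Submodule.mul_mem_mul (h.star_sup hn) ht
  rw [← mul_assoc] at this
  exact mul_le_mul_left h.sup_mul_sup _ this

/-- In s* t a last letter in P₂ meets a first letter in P₁, so no contraction occurs. -/
theorem inner_left_eq_zero [StarModule ℂ A] (h : IsFreeSplitting τ B₀ P₁ P₂)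
    {s t : A} (hs : s ∈ 𝒲 * 𝒩) (ht : t ∈ P₁ * (𝒲 * 𝒩)) :
    ⟪toL2 τ s, toL2 τ t⟫_ℂ = 0 := by
  rw [inner_toL2]
  exact h.trace_eq_zero (mul_left_mul_le (Submodule.mul_mem_mul (h.star_alt_sup hs) ht))

theorem inner_right_eq_zero [StarModule ℂ A] (h : IsFreeSplitting τ B₀ P₁ P₂)
    {s t : A} (hs : s ∈ 𝒩 * 𝒲) (ht : t ∈ (𝒩 * 𝒲) * P₁) :
    ⟪toL2 τ s, toL2 τ t⟫_ℂ = 0 := by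
  rw [inner_toL2, h.trace]
  refine h.trace_eq_zero (mul_left_mul_le ?_)
  rw [← mul_assoc]
  exact Submodule.mul_mem_mul ht (h.star_sup_alt hs)

/-- The letter u* v of P₁ separates the end of s* from the beginning of t, both in P₂; the outer
factors u and v* are absorbed into B₀ ⊔ P₁. -/
theorem inner_conj_eq_zero_of_mem_alt_sup [StarModule ℂ A] (h : IsFreeSplitting τ B₀ P₁ P₂)
    {u v s t : A} (hu : u ∈ 𝒩) (hv : v ∈ 𝒩)
    (huv : star u * v ∈ P₁) (hs : s ∈ 𝒲 * 𝒩) (ht : t ∈ 𝒲 * 𝒩) :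
    ⟪toL2 τ (u * s * star u), toL2 τ (v * t * star v)⟫_ℂ = 0 := by
  have e : star (u * s * star u) * (v * t * star v) =
      u * ((star s * ((star u * v) * t)) * star v) := by
    simp only [star_mul, star_star, mul_assoc]
  rw [inner_toL2, e]
  refine h.trace_eq_zero ?_
  have h1 := mul_left_mul_le (Submodule.mul_mem_mul (h.star_alt_sup hs)
    (Submodule.mul_mem_mul huv ht))
  have h2 := Submodule.mul_mem_mul hu (Submodule.mul_mem_mul h1 (h.star_sup hv))
  have e2 : 𝒩 * ((𝒩 * (𝒲 * 𝒩)) * 𝒩) = (𝒩 * 𝒩) * (𝒲 * (𝒩 * 𝒩)) := by simp only [mul_assoc]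
  rw [e2] at h2
  exact mul_le_mul' h.sup_mul_sup (mul_le_mul_right h.sup_mul_sup _) h2

/-- Here the words end in P₂, so the product is first rotated under the trace: v* u = (u* v)* then
separates t from s*. -/
theorem inner_conj_eq_zero_of_mem_sup_alt [StarModule ℂ A] (h : IsFreeSplitting τ B₀ P₁ P₂)
    {u v s t : A}
    (huv : star u * v ∈ P₁) (hs : s ∈ 𝒩 * 𝒲) (ht : t ∈ 𝒩 * 𝒲) :
    ⟪toL2 τ (u * s * star u), toL2 τ (v * t * star v)⟫_ℂ = 0 := by
  have e : star (u * s * star u) * (v * t * star v) =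
      (u * star s * (star u * v)) * (t * star v) := by
    simp only [star_mul, star_star, mul_assoc]
  have e' : t * star v * (u * star s * (star u * v)) =
      t * (star (star u * v) * star s) * (star u * v) := by
    simp only [star_mul, star_star, mul_assoc]
  rw [inner_toL2, e, h.trace, e']
  refine h.trace_eq_zero ?_
  have h1 := mul_left_mul_le (Submodule.mul_mem_mul ht
    (Submodule.mul_mem_mul (h.star_left _ huv) (h.star_sup_alt hs)))
  have h2 := Submodule.mul_mem_mul h1 (Submodule.mem_sup_right huv : star u * v ∈ 𝒩)
  have e2 : (𝒩 * (𝒲 * 𝒩)) * 𝒩 = 𝒩 * (𝒲 * (𝒩 * 𝒩)) := by simp only [mul_assoc]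
  rw [e2] at h2
  exact mul_le_mul_right (mul_le_mul_right h.sup_mul_sup _) _ h2

theorem left_mul_alt_mul_sup_le (h : IsFreeSplitting τ B₀ P₁ P₂)
    : P₁ * (𝒲 * 𝒩) ≤ P₁ * 𝒲 ⊔ P₁ * (𝒲 * P₁) := by
  rw [Submodule.mul_sup, Submodule.mul_sup]
  exact sup_le_sup (mul_le_mul_right h.alt_mul_base _) le_rfl

/-- Sorts words by their end letters: beginning in P₂, beginning in P₁ and ending in P₂, or
beginning and ending in P₁. Factors from B₀ are absorbed into W. -/
theorem sup_mul_alt_mul_sup_le (h : IsFreeSplitting τ B₀ P₁ P₂) :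
    𝒩 * (𝒲 * 𝒩) ≤ 𝒲 * 𝒩 ⊔ (P₁ * 𝒲 ⊔ P₁ * (𝒲 * P₁)) := by
  rw [Submodule.sup_mul]
  refine sup_le_sup ?_ h.left_mul_alt_mul_sup_le
  rw [← mul_assoc]
  exact mul_le_mul_left h.base_mul_alt _

/-- Multiplication on the right can contract the last letter into B₀ but leaves the first one in P₁;
`sup_mul_left_alt_left_le` is the counterpart on the left. -/
theorem left_alt_left_mul_sup_le (h : IsFreeSplitting τ B₀ P₁ P₂) :
    (P₁ * (𝒲 * P₁)) * 𝒩 ≤ P₁ * 𝒲 ⊔ P₁ * (𝒲 * P₁) := by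
  refine le_trans ?_ h.left_mul_alt_mul_sup_le
  rw [mul_assoc, mul_assoc]
  gcongr
  exact (mul_le_mul_left le_sup_right _).trans h.sup_mul_sup

theorem sup_mul_left_alt_left_le (h : IsFreeSplitting τ B₀ P₁ P₂)
    : 𝒩 * (P₁ * (𝒲 * P₁)) ≤ (𝒩 * 𝒲) * P₁ := by
  rw [← mul_assoc, ← mul_assoc]
  gcongr
  exact (mul_le_mul_right le_sup_right _).trans h.sup_mul_sup

theorem sup_mul_total_le (h : IsFreeSplitting τ B₀ P₁ P₂)
    : 𝒩 * (𝒩 ⊔ 𝒩 * (𝒲 * 𝒩)) ≤ 𝒩 ⊔ 𝒩 * (𝒲 * 𝒩) := by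
  rw [Submodule.mul_sup, ← mul_assoc]
  exact sup_le_sup h.sup_mul_sup (mul_le_mul_left h.sup_mul_sup _)

/-- With `sup_mul_total_le`, this makes the span of all words stable under left multiplication by
the generators, so that it contains the algebra they generate. -/
theorem right_mul_total_le (h : IsFreeSplitting τ B₀ P₁ P₂)
    : P₂ * (𝒩 ⊔ 𝒩 * (𝒲 * 𝒩)) ≤ 𝒩 ⊔ 𝒩 * (𝒲 * 𝒩) := by
  have hW : 𝒲 * 𝒩 ≤ 𝒩 * (𝒲 * 𝒩) := h.le_sup_mul _
  have hB : B₀ * 𝒩 ≤ 𝒩 := (mul_le_mul_left le_sup_left _).trans h.sup_mul_sup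
  -- When the new letter contracts with the first one into B₀, either nothing else remains or a
  -- letter of P₁ becomes the first.
  have h1 : P₂ * 𝒲 ≤ 𝒩 ⊔ 𝒩 * 𝒲 := by
    nth_rw 1 [altSpan]
    rw [Submodule.mul_iSup]
    refine iSup_le fun n => ?_
    cases n with
    | zero =>
      refine h.right_mul_right.trans (sup_le (le_sup_of_le_left le_sup_left) ?_)
      exact (le_altSpan P₁ P₂).trans (le_sup_of_le_right (h.le_sup_mul _))
    | succ n =>
      have hn : altProd P₁ P₂ n ≤ 𝒲 := le_iSup (altProd P₁ P₂) n
      rw [altProd, ← mul_assoc]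
      refine (mul_le_mul' h.right_mul_right (mul_le_mul_right hn _)).trans ?_
      rw [Submodule.sup_mul, ← mul_assoc]
      refine sup_le (le_sup_of_le_right ?_) (le_sup_of_le_right ?_)
      · exact mul_le_mul_left (h.base_mul_left.trans le_sup_right) _
      · refine le_trans ?_ (h.le_sup_mul _)
        exact (mul_le_mul_left (le_altSpan P₁ P₂) _).trans (altSpan_mul_altSpan_le _ _)
  rw [Submodule.mul_sup]
  refine sup_le (le_sup_of_le_right ?_) ?_
  · exact (mul_le_mul_left (le_altSpan P₁ P₂) _).trans hW
  · refine (mul_le_mul_right h.sup_mul_alt_mul_sup_le _).trans ?_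
    have h2 : P₂ * (P₁ * (𝒲 * 𝒩)) ≤ 𝒩 * (𝒲 * 𝒩) := by
      refine le_trans ?_ hW
      rw [← mul_assoc P₁, ← mul_assoc P₂]
      gcongr
      exact (mul_le_mul_left (le_altSpan P₁ P₂) _).trans (altSpan_mul_altSpan_le _ _)
    rw [Submodule.mul_sup P₂, Submodule.mul_sup P₂]
    refine sup_le ?_ (sup_le (le_sup_of_le_right ?_) (le_sup_of_le_right ?_))
    · rw [← mul_assoc]
      refine (mul_le_mul_left h1 _).trans ?_
      rw [Submodule.sup_mul, mul_assoc]
      exact sup_le_sup h.sup_mul_sup le_rfl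
    · refine le_trans ?_ h2
      gcongr
      exact h.le_mul_sup _
    · refine le_trans ?_ h2
      gcongr
      exact le_sup_right

end IsFreeSplitting

end Alternating

/-! ### The orthogonal complement of a subalgebra -/

section Complement

variable {HB HN : Type*} [NormedAddCommGroup HB] [InnerProductSpace ℂ HB] [CompleteSpace HB]
  [NormedAddCommGroup HN] [InnerProductSpace ℂ HN] [CompleteSpace HN]
  {B : TracialVNA HB} {N : TracialVNA HN} (i : Inclusion B N)

/-- The underlying linear map of an inclusion. -/
def Inclusion.lin : B →ₗ[ℂ] N := i.toStarAlgHom.toAlgHom.toLinearMap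

theorem Inclusion.lin_apply (b : B) : i.lin b = i b := rfl

/-- `N ⊖ B` as a subspace of `N`. -/
def Inclusion.compl : Submodule ℂ N where
  carrier := ominus N.tr (Set.range i)
  add_mem' hx hy z hz := by rw [map_add, inner_add_right, hx z hz, hy z hz, add_zero]
  zero_mem' z _ := by rw [map_zero, inner_zero_right]
  smul_mem' c x hx z hz := by rw [LinearMap.map_smul, inner_smul_right, hx z hz, mul_zero]

variable {i}

theorem Inclusion.mem_compl_iff {x : N} : x ∈ i.compl ↔ ∀ b, N.tr (i b * x) = 0 := by
  constructor
  · intro h b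
    have := h (i (star b)) ⟨_, rfl⟩
    rwa [inner_toL2, i.map_star, star_star] at this
  · rintro h _ ⟨b, rfl⟩
    rw [inner_toL2, ← i.map_star]
    exact h _

theorem Inclusion.star_mem_compl {x : N} (h : x ∈ i.compl) : star x ∈ i.compl := by
  refine mem_compl_iff.2 fun b => ?_
  have h1 := N.tr.map_star (i b * star x)
  rw [star_mul, star_star, ← i.map_star, N.tr_mul_comm, mem_compl_iff.1 h] at h1
  exact (map_eq_zero (starRingEnd ℂ)).1 h1.symm

theorem Inclusion.mul_mem_compl {x : N} (h : x ∈ i.compl) (b : B) : i b * x ∈ i.compl := by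
  refine mem_compl_iff.2 fun c => ?_
  rw [← mul_assoc, ← i.map_mul]
  exact mem_compl_iff.1 h _

theorem Inclusion.mul_mem_compl' {x : N} (h : x ∈ i.compl) (b : B) : x * i b ∈ i.compl := by
  have := star_mem_compl (mul_mem_compl (star_mem_compl h) (star b))
  rwa [star_mul, star_star, ← i.map_star, star_star] at this

theorem Inclusion.exists_sub_mem_compl (i : Inclusion B N) (x : N) : ∃ e : B, x - i e ∈ i.compl :=
  let ⟨e, _, he⟩ := i.exists_isCondExp x
  ⟨e, he.sub_mem_ominus⟩

theorem Inclusion.IsCondExp.mem_compl {x : N} (h : i.IsCondExp x 0) : x ∈ i.compl := by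
  refine mem_compl_iff.2 fun b => ?_
  rw [h, mul_zero, LinearMap.map_zero]

/-- Subtracting the conditional expectation splits each element of N. This identifies the abstract
space B₀ ⊔ P₁ with the image of N₁. -/
theorem Inclusion.range_lin_sup_map_compl {HM : Type*} [NormedAddCommGroup HM]
    [InnerProductSpace ℂ HM] [CompleteSpace HM] {M : TracialVNA HM} (i : Inclusion B N)
    (j : Inclusion N M) :
    LinearMap.range (j.comp i).lin ⊔ i.compl.map j.lin = LinearMap.range j.lin := by
  refine le_antisymm (sup_le ?_ LinearMap.map_le_range) ?_
  · rintro _ ⟨b, rfl⟩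
    exact ⟨i b, rfl⟩
  · rintro _ ⟨x, rfl⟩
    obtain ⟨e, he⟩ := i.exists_sub_mem_compl x
    have : j.lin x = (j.comp i).lin e + j.lin (x - i e) := by
      rw [LinearMap.map_sub]
      exact (add_sub_cancel _ _).symm
    rw [this]
    exact Submodule.add_mem_sup ⟨e, rfl⟩ (Submodule.mem_map_of_mem he)

end Complement

/-! ### Reduced words in an amalgamated free product -/

section FreeProduct

variable {HB HN₁ HN₂ HM : Type*}
  [NormedAddCommGroup HB] [InnerProductSpace ℂ HB] [CompleteSpace HB]
  [NormedAddCommGroup HN₁] [InnerProductSpace ℂ HN₁] [CompleteSpace HN₁]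
  [NormedAddCommGroup HN₂] [InnerProductSpace ℂ HN₂] [CompleteSpace HN₂]
  [NormedAddCommGroup HM] [InnerProductSpace ℂ HM] [CompleteSpace HM]
  {B : TracialVNA HB} {N₁ : TracialVNA HN₁} {N₂ : TracialVNA HN₂} {M : TracialVNA HM}
  {i₁ : Inclusion B N₁} {i₂ : Inclusion B N₂} {j₁ : Inclusion N₁ M} {j₂ : Inclusion N₂ M}

variable (i₁ i₂) in
/-- A word is reduced if its letters lie alternately in `N₁ ⊖ B` and `N₂ ⊖ B`. -/
structure IsReducedWord (w : List (N₁ ⊕ N₂)) : Prop where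
  isChain : w.IsChain (fun a b => a.isLeft ≠ b.isLeft)
  left : ∀ a, Sum.inl a ∈ w → a ∈ i₁.compl
  right : ∀ a, Sum.inr a ∈ w → a ∈ i₂.compl

theorem IsReducedWord.inl_cons {a : N₁} {b : N₂} {w : List (N₁ ⊕ N₂)}
    (h : IsReducedWord i₁ i₂ (Sum.inr b :: w)) (ha : a ∈ i₁.compl) :
    IsReducedWord i₁ i₂ (Sum.inl a :: Sum.inr b :: w) where
  isChain := List.isChain_cons_cons.2 ⟨by simp, h.isChain⟩
  left c hc := by
    rcases List.mem_cons.1 hc with hc | hc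
    · rwa [Sum.inl_injective hc]
    · exact h.left c hc
  right c hc := h.right c (by simpa using hc)

theorem IsReducedWord.inr_cons {a : N₁} {b : N₂} {w : List (N₁ ⊕ N₂)}
    (h : IsReducedWord i₁ i₂ (Sum.inl a :: w)) (hb : b ∈ i₂.compl) :
    IsReducedWord i₁ i₂ (Sum.inr b :: Sum.inl a :: w) where
  isChain := List.isChain_cons_cons.2 ⟨by simp, h.isChain⟩
  left c hc := h.left c (by simpa using hc)
  right c hc := by
    rcases List.mem_cons.1 hc with hc | hc
    · rwa [Sum.inr_injective hc]
    · exact h.right c hc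

variable (j₁ j₂) in
/-- The product in `M` of the letters of a word. -/
def wordProd (w : List (N₁ ⊕ N₂)) : M := (w.map (Sum.elim j₁ j₂)).prod

theorem wordProd_cons (a : N₁ ⊕ N₂) (w : List (N₁ ⊕ N₂)) :
    wordProd j₁ j₂ (a :: w) = Sum.elim j₁ j₂ a * wordProd j₁ j₂ w := by
  rw [wordProd, List.map_cons, List.prod_cons, wordProd]

/-- Passes from products of subspaces to the lists in which freeness is phrased. Keeping track of
the first letter in N₂ ⊖ B allows a letter of N₁ ⊖ B to be put in front. -/
theorem altProd_le_span_wordProd (n : ℕ) :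
    altProd (i₁.compl.map j₁.lin) (i₂.compl.map j₂.lin) n ≤
      Submodule.span ℂ {m | ∃ b w, IsReducedWord i₁ i₂ (Sum.inr b :: w) ∧
        m = wordProd j₁ j₂ (Sum.inr b :: w)} := by
  induction n with
  | zero =>
    rintro _ ⟨b, hb, rfl⟩
    refine Submodule.subset_span ⟨b, [], ⟨List.isChain_singleton _, by simp, ?_⟩, ?_⟩
    · intro c hc
      rw [List.mem_singleton] at hc
      rwa [Sum.inr_injective hc]
    · rw [wordProd_cons, wordProd, List.map_nil, List.prod_nil, mul_one]
      rfl
  | succ n ih =>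
    rw [altProd]
    refine (mul_le_mul_right (mul_le_mul_right ih _) _).trans ?_
    refine Submodule.mul_le.2 fun y hy z hz => ?_
    induction hz using Submodule.mul_induction_on' with
    | mem_mul_mem a ha v hv =>
      induction hv using Submodule.span_induction with
      | mem v hv =>
        obtain ⟨b, w, hw, rfl⟩ := hv
        obtain ⟨a, ha, rfl⟩ := ha
        obtain ⟨y, hy, rfl⟩ := hy
        refine Submodule.subset_span ⟨y, _, (hw.inl_cons ha).inr_cons hy, ?_⟩
        rw [wordProd_cons (Sum.inr y), wordProd_cons (Sum.inl a)]
        rfl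
      | zero => rw [mul_zero, mul_zero]; exact zero_mem _
      | add v v' _ _ h h' => rw [mul_add, mul_add]; exact add_mem h h'
      | smul c v _ h => rw [mul_smul_comm, mul_smul_comm]; exact Submodule.smul_mem _ c h
    | add z _ z' _ h h' => rw [mul_add]; exact add_mem h h'

theorem IsAmalgamatedFreeProduct.tr_mul_wordProd (hM : IsAmalgamatedFreeProduct i₁ i₂ j₁ j₂)
    (b : B) {w : List (N₁ ⊕ N₂)} (hw : IsReducedWord i₁ i₂ w) (h0 : w ≠ []) :
    M.tr (j₁ (i₁ b) * wordProd j₁ j₂ w) = 0 := by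
  have := hM.free w h0 hw.isChain hw.left hw.right b
  rw [mul_zero, LinearMap.map_zero] at this
  exact this

theorem IsAmalgamatedFreeProduct.isFreeSplitting (hM : IsAmalgamatedFreeProduct i₁ i₂ j₁ j₂) :
    IsFreeSplitting M.tr (LinearMap.range (j₁.comp i₁).lin) (i₁.compl.map j₁.lin)
      (i₂.compl.map j₂.lin) where
  trace := M.tr_mul_comm
  one_mem := ⟨1, (j₁.comp i₁).map_one⟩
  star_base := by
    rintro _ ⟨b, rfl⟩
    exact ⟨star b, (j₁.comp i₁).map_star b⟩
  star_left := by
    rintro _ ⟨a, ha, rfl⟩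
    exact ⟨star a, Inclusion.star_mem_compl ha, j₁.map_star a⟩
  star_right := by
    rintro _ ⟨a, ha, rfl⟩
    exact ⟨star a, Inclusion.star_mem_compl ha, j₂.map_star a⟩
  base_mul_base := Submodule.mul_le.2 <| by
    rintro _ ⟨b, rfl⟩ _ ⟨c, rfl⟩
    exact ⟨b * c, (j₁.comp i₁).map_mul b c⟩
  base_mul_left := Submodule.mul_le.2 <| by
    rintro _ ⟨b, rfl⟩ _ ⟨a, ha, rfl⟩
    exact ⟨i₁ b * a, Inclusion.mul_mem_compl ha b, j₁.map_mul _ _⟩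
  base_mul_right := Submodule.mul_le.2 <| by
    rintro _ ⟨b, rfl⟩ _ ⟨a, ha, rfl⟩
    refine ⟨i₂ b * a, Inclusion.mul_mem_compl ha b, (j₂.map_mul _ _).trans ?_⟩
    rw [← hM.comm]
    rfl
  left_mul_base := Submodule.mul_le.2 <| by
    rintro _ ⟨a, ha, rfl⟩ _ ⟨b, rfl⟩
    exact ⟨a * i₁ b, Inclusion.mul_mem_compl' ha b, j₁.map_mul _ _⟩
  right_mul_base := Submodule.mul_le.2 <| by
    rintro _ ⟨a, ha, rfl⟩ _ ⟨b, rfl⟩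
    refine ⟨a * i₂ b, Inclusion.mul_mem_compl' ha b, (j₂.map_mul _ _).trans ?_⟩
    rw [← hM.comm]
    rfl
  left_mul_left := Submodule.mul_le.2 <| by
    rintro _ ⟨a, ha, rfl⟩ _ ⟨b, hb, rfl⟩
    rw [i₁.range_lin_sup_map_compl]
    exact ⟨a * b, j₁.map_mul a b⟩
  right_mul_right := Submodule.mul_le.2 <| by
    rintro _ ⟨a, ha, rfl⟩ _ ⟨b, hb, rfl⟩
    have : LinearMap.range (j₁.comp i₁).lin = LinearMap.range (j₂.comp i₂).lin :=
      congrArg LinearMap.range (LinearMap.ext hM.comm)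
    rw [this, i₂.range_lin_sup_map_compl]
    exact ⟨a * b, j₂.map_mul a b⟩
  free n x hx w hw := by
    obtain ⟨_, ⟨b, rfl⟩, _, ⟨a, ha, rfl⟩, rfl⟩ := Submodule.mem_sup.1 hx
    replace hw := altProd_le_span_wordProd n hw
    induction hw using Submodule.span_induction with
    | mem w hw =>
      obtain ⟨c, w, hw, rfl⟩ := hw
      -- The B-part of `x` serves as the coefficient in the freeness condition; its part in N₁ ⊖ B
      -- becomes the first letter of a longer reduced word, with coefficient 1.
      have h1 := hM.tr_mul_wordProd b hw (List.cons_ne_nil _ _)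
      have h2 := hM.tr_mul_wordProd 1 (hw.inl_cons ha) (List.cons_ne_nil _ _)
      rw [i₁.map_one, j₁.map_one, one_mul, wordProd_cons (Sum.inl a)] at h2
      rw [add_mul, LinearMap.map_add]
      exact (congrArg₂ (· + ·) h1 h2).trans (add_zero 0)
    | zero => rw [mul_zero, LinearMap.map_zero]
    | add v w _ _ hv hw => rw [mul_add, LinearMap.map_add, hv, hw, add_zero]
    | smul c w _ hw => rw [mul_smul_comm, LinearMap.map_smul, hw, smul_zero]

/-- `N₁ + N₁ W N₁` is dense in `L²(M)`, where `W` is spanned by the words that begin and end in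
`N₂ ⊖ B`. -/
theorem IsAmalgamatedFreeProduct.exists_norm_toL2_sub_lt
    (hM : IsAmalgamatedFreeProduct i₁ i₂ j₁ j₂) (y : M) {ε : ℝ} (hε : 0 < ε) :
    ∃ a ∈ LinearMap.range j₁.lin ⊔ LinearMap.range j₁.lin *
      (altSpan (i₁.compl.map j₁.lin) (i₂.compl.map j₂.lin) * LinearMap.range j₁.lin),
      ‖toL2 M.tr (y - a)‖ < ε := by
  let S := StarAlgebra.adjoin ℂ (Set.range j₁ ∪ Set.range j₂)
  obtain ⟨a, ha, hlt⟩ := M.exists_norm_toL2_sub_lt S (by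
    rw [← hM.generates]
    refine Set.centralizer_subset (Set.centralizer_subset (Set.image_mono ?_))
    exact StarAlgebra.subset_adjoin ℂ _) y hε
  refine ⟨a, ?_, hlt⟩
  have hF := hM.isFreeSplitting
  have h1 := hF.sup_mul_total_le
  have h2 := hF.right_mul_total_le
  have hone := hF.one_mem_sup
  rw [i₁.range_lin_sup_map_compl j₁] at h1 h2 hone
  set T := LinearMap.range j₁.lin ⊔ LinearMap.range j₁.lin *
      (altSpan (i₁.compl.map j₁.lin) (i₂.compl.map j₂.lin) * LinearMap.range j₁.lin)
  -- `T` contains 1 and is stable under left multiplication by N₁ and N₂, hence contains the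
  -- *-algebra they generate.
  have hgen : ∀ s ∈ Set.range j₁ ∪ Set.range j₂, ∀ t ∈ T, s * t ∈ T := by
    rintro _ (⟨x, rfl⟩ | ⟨x, rfl⟩) t ht
    · exact h1 (Submodule.mul_mem_mul ⟨x, rfl⟩ ht)
    · have hx : j₂.lin x ∈ LinearMap.range (j₂.comp i₂).lin ⊔ i₂.compl.map j₂.lin := by
        rw [i₂.range_lin_sup_map_compl]
        exact ⟨x, rfl⟩
      obtain ⟨_, ⟨b, rfl⟩, c, hc, hbc⟩ := Submodule.mem_sup.1 hx
      rw [← Inclusion.lin_apply, ← hbc, add_mul]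
      refine T.add_mem (h1 (Submodule.mul_mem_mul ⟨i₁ b, hM.comm b⟩ ht))
        (h2 (Submodule.mul_mem_mul hc ht))
  have hadj : ∀ a ∈ Algebra.adjoin ℂ ((Set.range j₁ ∪ Set.range j₂) ∪
      star (Set.range j₁ ∪ Set.range j₂)), ∀ t ∈ T, a * t ∈ T := by
    intro a ha
    induction ha using Algebra.adjoin_induction with
    | mem s hs =>
      refine hgen s (hs.elim id ?_)
      rintro (⟨x, hx⟩ | ⟨x, hx⟩)
      · exact Or.inl ⟨star x, by rw [j₁.map_star, hx, star_star]⟩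
      · exact Or.inr ⟨star x, by rw [j₂.map_star, hx, star_star]⟩
    | algebraMap c =>
      intro t ht
      rw [← Algebra.smul_def]
      exact T.smul_mem c ht
    | add x y _ _ hx hy =>
      intro t ht
      rw [add_mul]
      exact T.add_mem (hx t ht) (hy t ht)
    | mul x y _ _ hx hy =>
      intro t ht
      rw [mul_assoc]
      exact hx _ (hy t ht)
  have := hadj a ha 1 (Submodule.mem_sup_left hone)
  rwa [mul_one] at this

end FreeProduct

/-! ### Asymptotically orthogonal vectors -/

section Hilbert

variable {E : Type*} [SeminormedAddCommGroup E] [InnerProductSpace ℂ E]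

/-- Cauchy–Schwarz, with `v` an orthogonal component of `w`. It bounds an unwanted component by any
small vector that has it. -/
theorem norm_le_of_inner_self_eq {v w : E} (h : ⟪v, v⟫_ℂ = ⟪v, w⟫_ℂ) : ‖v‖ ≤ ‖w‖ := by
  rcases (norm_nonneg v).eq_or_lt with h0 | h0
  · rw [← h0]; exact norm_nonneg w
  · have h1 : ‖v‖ * ‖v‖ ≤ ‖v‖ * ‖w‖ := by
      rw [← inner_self_eq_norm_mul_norm (𝕜 := ℂ), h]
      exact (Complex.re_le_norm _).trans (norm_inner_le_norm _ _)
    exact le_of_mul_le_mul_left h1 h0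

theorem norm_sum_sq_of_pairwise_orthogonal {I : Type*} (F : Finset I) {κ : I → E} {c : ℝ}
    (hκ : ∀ i, ‖κ i‖ = c) (horth : ∀ i j, i ≠ j → ⟪κ i, κ j⟫_ℂ = 0) :
    ‖∑ i ∈ F, κ i‖ ^ 2 = F.card * c ^ 2 := by
  classical
  have h1 : ⟪∑ i ∈ F, κ i, ∑ i ∈ F, κ i⟫_ℂ = (F.card : ℂ) * (c : ℂ) ^ 2 := by
    rw [sum_inner, ← nsmul_eq_mul, ← Finset.sum_const]
    refine Finset.sum_congr rfl fun i hi => ?_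
    rw [inner_sum, Finset.sum_eq_single i (fun j _ hj => horth i j hj.symm) fun h => absurd hi h,
      inner_self_eq_norm_sq_to_K, hκ]
    rfl
  have h2 := inner_self_eq_norm_sq (𝕜 := ℂ) (∑ i ∈ F, κ i)
  rw [h1] at h2
  rw [← h2]
  norm_cast

/-- If infinitely many pairwise orthogonal vectors of the same norm `cₙ` have nearly the inner
product `cₙ²` with a bounded vector, then `cₙ → 0`. -/
theorem tendsto_zero_of_pairwise_orthogonal {I ι : Type*} [Infinite I] {l : Filter ι}
    {κ : I → ι → E} {ξ : ι → E} {c : ι → ℝ} {C : ℝ} {δ : I → ι → ℝ}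
    (hκ : ∀ i n, ‖κ i n‖ = c n) (horth : ∀ i j n, i ≠ j → ⟪κ i n, κ j n⟫_ℂ = 0)
    (hξ : ∀ n, ‖ξ n‖ ≤ C) (hδ : ∀ i, Tendsto (δ i) l (𝓝 0)) (hδ0 : ∀ i n, 0 ≤ δ i n)
    (h : ∀ i n, c n ^ 2 - (⟪κ i n, ξ n⟫_ℂ).re ≤ δ i n * c n) : Tendsto c l (𝓝 0) := by
  obtain ⟨i₀⟩ : Nonempty I := inferInstance
  have hc (n) : 0 ≤ c n := hκ i₀ n ▸ norm_nonneg _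
  -- The sum over `F` has norm (k + 1) c. Cauchy–Schwarz against ξ gives (k + 1)² c² - c ∑ δ ≤ (k +
  -- 1) c C; divide by (k + 1)² c.
  have key (k : ℕ) (F : Finset I) (hF : F.card = (k + 1) ^ 2) (n : ι) :
      c n ≤ C / ((k : ℝ) + 1) + ∑ i ∈ F, δ i n := by
    have hk : (1 : ℝ) ≤ (k : ℝ) + 1 := by simp
    have hk0 : (0 : ℝ) < (k : ℝ) + 1 := by positivity
    have hC : 0 ≤ C := (norm_nonneg _).trans (hξ n)
    have hδF : 0 ≤ ∑ i ∈ F, δ i n := Finset.sum_nonneg fun i _ => hδ0 i n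
    rcases (hc n).eq_or_lt with h0 | h0
    · rw [← h0]; positivity
    have hFr : (F.card : ℝ) = ((k : ℝ) + 1) ^ 2 := by rw [hF]; push_cast; ring
    have hnorm : ‖∑ i ∈ F, κ i n‖ = ((k : ℝ) + 1) * c n := by
      rw [← sq_eq_sq₀ (norm_nonneg _) (by positivity),
        norm_sum_sq_of_pairwise_orthogonal F (fun i => hκ i n) fun i j => horth i j n, hFr, mul_pow]
    have h1 : (⟪∑ i ∈ F, κ i n, ξ n⟫_ℂ).re ≤ ((k : ℝ) + 1) * c n * C := by
      rw [← hnorm]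
      refine (Complex.re_le_norm _).trans ((norm_inner_le_norm _ _).trans ?_)
      gcongr
      exact hξ n
    have h2 := Finset.sum_le_sum fun i (_ : i ∈ F) => h i n
    rw [Finset.sum_sub_distrib, Finset.sum_const, nsmul_eq_mul, hFr, ← Finset.sum_mul,
      ← Complex.re_sum, ← sum_inner] at h2
    have h3 : c n * (((k : ℝ) + 1) ^ 2 * c n) ≤
        c n * (((k : ℝ) + 1) * C + ∑ i ∈ F, δ i n) := by linarith
    have h4 := le_of_mul_le_mul_left h3 h0
    have h5 : ∑ i ∈ F, δ i n ≤ ((k : ℝ) + 1) ^ 2 * ∑ i ∈ F, δ i n :=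
      le_mul_of_one_le_left hδF (one_le_pow₀ hk)
    have h6 : ((k : ℝ) + 1) ^ 2 * (C / ((k : ℝ) + 1)) = ((k : ℝ) + 1) * C := by field_simp
    refine le_of_mul_le_mul_left (a := ((k : ℝ) + 1) ^ 2) ?_ (by positivity)
    rw [mul_add, h6]
    linarith
  rw [Metric.tendsto_nhds]
  intro ε hε
  have hlim : Tendsto (fun k : ℕ => C / ((k : ℝ) + 1)) atTop (𝓝 0) := by
    simpa [div_eq_mul_inv] using (tendsto_one_div_add_atTop_nhds_zero_nat (𝕜 := ℝ)).const_mul C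
  obtain ⟨k, hk⟩ := (hlim.eventually (gt_mem_nhds (half_pos hε))).exists
  obtain ⟨F, hF⟩ := Infinite.exists_subset_card_eq I ((k + 1) ^ 2)
  have hsum : Tendsto (fun n => ∑ i ∈ F, δ i n) l (𝓝 0) := by
    simpa using tendsto_finsetSum F fun i _ => hδ i
  filter_upwards [hsum.eventually (gt_mem_nhds (half_pos hε))] with n hn
  rw [Real.dist_0_eq_abs, abs_of_nonneg (hc n)]
  linarith [key k F hF n]

end Hilbert

/-! ### Sequences with vanishing difference in trace norm -/

section AsympEq

variable {A : Type*} [Ring A] [StarRing A] [Algebra ℂ A] [StarModule ℂ A]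

/-- Multiplication by an element of `A` is bounded for the norm of `L²(A, τ)`. -/
structure HasBoundedMul (τ : PosFunctional A) : Prop where
  mul_left : ∀ a : A, ∃ C : ℝ, 0 ≤ C ∧ ∀ y, ‖toL2 τ (a * y)‖ ≤ C * ‖toL2 τ y‖
  mul_right : ∀ a : A, ∃ C : ℝ, 0 ≤ C ∧ ∀ y, ‖toL2 τ (y * a)‖ ≤ ‖toL2 τ y‖ * C

theorem TracialVNA.hasBoundedMul {H : Type*} [NormedAddCommGroup H] [InnerProductSpace ℂ H]
    [CompleteSpace H] (M : TracialVNA H) : HasBoundedMul M.tr where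
  mul_left a := ⟨‖a‖, norm_nonneg _, M.norm_toL2_mul_le a⟩
  mul_right a := ⟨‖a‖, norm_nonneg _, fun y => M.norm_toL2_mul_le' y a⟩

/-- `‖xₙ - yₙ‖₂ → 0` along `l`. -/
def AsympEq (τ : PosFunctional A) (l : Filter ℕ) (x y : ℕ → A) : Prop :=
  Tendsto (fun n => ‖toL2 τ (x n - y n)‖) l (𝓝 0)

namespace AsympEq

variable {τ : PosFunctional A} {l : Filter ℕ} {x y z : ℕ → A}

theorem symm (h : AsympEq τ l x y) : AsympEq τ l y x :=
  Tendsto.congr (fun n => by rw [← norm_neg, ← map_neg, neg_sub]) h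

theorem of_le {f : ℕ → ℝ} (hf : Tendsto f l (𝓝 0)) (h : ∀ n, ‖toL2 τ (x n - y n)‖ ≤ f n) :
    AsympEq τ l x y :=
  squeeze_zero (fun _ => norm_nonneg _) h hf

theorem trans (h : AsympEq τ l x y) (h' : AsympEq τ l y z) : AsympEq τ l x z := by
  have h2 := Tendsto.add h h'
  rw [add_zero] at h2
  refine of_le h2 fun n => ?_
  rw [← sub_add_sub_cancel (x n) (y n)]
  exact norm_toL2_add_le _ _ _

theorem const_mul (hτ : HasBoundedMul τ) (h : AsympEq τ l x y) (a : A) :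
    AsympEq τ l (fun n => a * x n) (fun n => a * y n) := by
  obtain ⟨C, _, hC⟩ := hτ.mul_left a
  have h2 := Tendsto.const_mul C h
  rw [mul_zero] at h2
  refine of_le h2 fun n => ?_
  rw [← mul_sub]
  exact hC _

theorem mul_const (hτ : HasBoundedMul τ) (h : AsympEq τ l x y) (a : A) :
    AsympEq τ l (fun n => x n * a) (fun n => y n * a) := by
  obtain ⟨C, _, hC⟩ := hτ.mul_right a
  have h2 := Tendsto.mul_const C h
  rw [zero_mul] at h2
  refine of_le h2 fun n => ?_
  rw [← sub_mul]
  exact hC _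

theorem tendsto_inner_sub {x' y' : ℕ → A} (h : AsympEq τ l x x') (h' : AsympEq τ l y y')
    {C D : ℝ} (hx : ∀ n, ‖toL2 τ (x n)‖ ≤ C) (hy : ∀ n, ‖toL2 τ (y n)‖ ≤ D) :
    Tendsto (fun n => ⟪toL2 τ (x n), toL2 τ (y n)⟫_ℂ -
      ⟪toL2 τ (x' n), toL2 τ (y' n)⟫_ℂ) l (𝓝 0) := by
  have hlim : Tendsto (fun n => C * ‖toL2 τ (y n - y' n)‖ + ‖toL2 τ (x n - x' n)‖ * D +
      ‖toL2 τ (x n - x' n)‖ * ‖toL2 τ (y n - y' n)‖) l (𝓝 0) := by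
    simpa using ((Tendsto.const_mul C h').add (Tendsto.mul_const D h)).add (Tendsto.mul h h')
  refine squeeze_zero_norm (fun n => ?_) hlim
  -- Expanded around `x` and `y`, so that no bound on the replacements `x'` and `y'` is required.
  have e : ⟪toL2 τ (x n), toL2 τ (y n)⟫_ℂ - ⟪toL2 τ (x' n), toL2 τ (y' n)⟫_ℂ =
      ⟪toL2 τ (x n), toL2 τ (y n - y' n)⟫_ℂ + ⟪toL2 τ (x n - x' n), toL2 τ (y n)⟫_ℂ -
        ⟪toL2 τ (x n - x' n), toL2 τ (y n - y' n)⟫_ℂ := by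
    simp only [inner_toL2_sub_left, inner_toL2_sub_right]
    ring
  rw [e]
  refine (norm_sub_le _ _).trans (add_le_add ((norm_add_le _ _).trans (add_le_add ?_ ?_)) ?_)
  · exact (norm_inner_le_norm _ _).trans (by gcongr; exact hx n)
  · exact (norm_inner_le_norm _ _).trans (by gcongr; exact hy n)
  · exact norm_inner_le_norm _ _

end AsympEq

end AsympEq

/-! ### Asymptotically central sequences in a free splitting -/

section Splitting

variable {A : Type*} [Ring A] [StarRing A] [Algebra ℂ A] [StarModule ℂ A]
  {τ : PosFunctional A} {B₀ P₁ P₂ : Submodule ℂ A} {l : Filter ℕ} {x q : ℕ → A}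

local notation "𝒩" => B₀ ⊔ P₁
local notation "𝒲" => altSpan P₁ P₂

theorem norm_toL2_conj (hτ : ∀ x y, τ (x * y) = τ (y * x)) (u y : A) (hu : star u * u = 1) :
    ‖toL2 τ (u * y * star u)‖ = ‖toL2 τ y‖ := by
  have e : star (u * y * star u) * (u * y * star u) =
      u * (star y * ((star u * u) * (y * star u))) := by
    simp only [star_mul, star_star, mul_assoc]
  rw [← sq_eq_sq₀ (norm_nonneg _) (norm_nonneg _), norm_toL2_sq, norm_toL2_sq, e, hu, one_mul,
    hτ]
  simp only [mul_assoc]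
  rw [hu, mul_one]

/-- An orthogonal component `kₙ` of an asymptotically central sequence, whose conjugates by
infinitely many unitaries are pairwise orthogonal, vanishes asymptotically. -/
theorem tendsto_norm_toL2_zero_of_conj (hτ : ∀ x y, τ (x * y) = τ (y * x))
    (hτb : HasBoundedMul τ) {I : Type*} [Infinite I] {u : I → A}
    (hu : ∀ i, star (u i) * u i = 1) {k s r : ℕ → A}
    (hcomm : ∀ i, AsympEq τ l (fun n => x n * u i) (fun n => u i * x n))
    {C : ℝ} (hx : ∀ n, ‖toL2 τ (x n)‖ ≤ C)
    (horth : ∀ i j n, i ≠ j →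
      ⟪toL2 τ (u i * k n * star (u i)), toL2 τ (u j * k n * star (u j))⟫_ℂ = 0)
    (hsum : ∀ n, x n = k n + s n + r n)
    (hks : ∀ n, ⟪toL2 τ (k n), toL2 τ (s n)⟫_ℂ = 0)
    (hr : Tendsto (fun n => ‖toL2 τ (r n)‖) l (𝓝 0)) :
    Tendsto (fun n => ‖toL2 τ (k n)‖) l (𝓝 0) := by
  have hcomm' (i : I) : AsympEq τ l (fun n => star (u i) * (x n * u i)) x := by
    have := (hcomm i).const_mul hτb (star (u i))
    simpa only [← mul_assoc, hu, one_mul] using this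
  refine tendsto_zero_of_pairwise_orthogonal
    (κ := fun i n => toL2 τ (u i * k n * star (u i))) (ξ := fun n => toL2 τ (x n)) (C := C)
    -- Since ⟨u k u*, x⟩ = ⟨k, u* x u⟩ and `k` is orthogonal to `s`, this differs from ‖k‖² only
    -- through the remainder and the failure of `u` to commute with `x`.
    (δ := fun i n => ‖toL2 τ (r n)‖ + ‖toL2 τ (star (u i) * (x n * u i) - x n)‖)
    (fun i n => norm_toL2_conj hτ _ _ (hu i)) horth hx (fun i => ?_) (fun i n => by positivity)
    (fun i n => ?_)
  · have := Tendsto.add hr (hcomm' i)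
    rwa [add_zero] at this
  · have e1 : ⟪toL2 τ (u i * k n * star (u i)), toL2 τ (x n)⟫_ℂ =
        ⟪toL2 τ (k n), toL2 τ (star (u i) * (x n * u i))⟫_ℂ := by
      rw [inner_toL2, inner_toL2, star_mul, star_star, mul_assoc, hτ, star_mul]
      simp only [mul_assoc]
    have e2 : star (u i) * (x n * u i) =
        k n + s n + (r n + (star (u i) * (x n * u i) - x n)) := by
      rw [← add_assoc, ← hsum, add_sub_cancel]
    have e3 : ⟪toL2 τ (k n), toL2 τ (star (u i) * (x n * u i))⟫_ℂ =
        ⟪toL2 τ (k n), toL2 τ (k n)⟫_ℂ +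
          ⟪toL2 τ (k n), toL2 τ (r n + (star (u i) * (x n * u i) - x n))⟫_ℂ := by
      conv_lhs => rw [e2]
      rw [inner_toL2_add_right, inner_toL2_add_right, hks, add_zero]
    rw [e1, e3, Complex.add_re]
    have h1 : (⟪toL2 τ (k n), toL2 τ (k n)⟫_ℂ).re = ‖toL2 τ (k n)‖ ^ 2 :=
      inner_self_eq_norm_sq (𝕜 := ℂ) _
    have h2 := (Complex.abs_re_le_norm _).trans (norm_inner_le_norm (𝕜 := ℂ) (toL2 τ (k n))
      (toL2 τ (r n + (star (u i) * (x n * u i) - x n))))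
    have h3 := norm_toL2_add_le τ (r n) (star (u i) * (x n * u i) - x n)
    have h4 := mul_le_mul_of_nonneg_left h3 (norm_nonneg (toL2 τ (k n)))
    have h5 := neg_le_of_abs_le (h2.trans h4)
    rw [h1]
    linarith

/-- A sequence that asymptotically commutes with `N₁` and is asymptotically orthogonal to `N₁` is
asymptotic to a sequence of sums of words that begin and end with a letter in `N₁ ⊖ B`. -/
theorem IsFreeSplitting.exists_asympEq (h : IsFreeSplitting τ B₀ P₁ P₂)
    (hτb : HasBoundedMul τ)
    (hdense : ∀ (y : A) (ε : ℝ), 0 < ε → ∃ a ∈ 𝒩 ⊔ 𝒩 * (𝒲 * 𝒩), ‖toL2 τ (y - a)‖ < ε)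
    (hl : l ≤ atTop) {I : Type*} [Infinite I] {u : I → A} (hu : ∀ i, star (u i) * u i = 1)
    (huN : ∀ i, u i ∈ 𝒩) (huP : ∀ i j, i ≠ j → star (u i) * u j ∈ P₁)
    (hcomm : ∀ m ∈ 𝒩, AsympEq τ l (fun n => x n * m) (fun n => m * x n))
    {C : ℝ} (hx : ∀ n, ‖toL2 τ (x n)‖ ≤ C) {e : ℕ → A}
    (he : ∀ n, ∀ m ∈ 𝒩, ⟪toL2 τ m, toL2 τ (x n)⟫_ℂ = ⟪toL2 τ m, toL2 τ (e n)⟫_ℂ)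
    (he0 : Tendsto (fun n => ‖toL2 τ (e n)‖) l (𝓝 0)) :
    ∃ q : ℕ → A, (∀ n, q n ∈ P₁ * (𝒲 * P₁)) ∧ AsympEq τ l x q := by
  have hex (n : ℕ) : ∃ p ∈ 𝒩, ∃ k ∈ 𝒲 * 𝒩, ∃ m ∈ P₁ * 𝒲, ∃ q ∈ P₁ * (𝒲 * P₁), ∃ r : A,
      ‖toL2 τ r‖ < 1 / ((n : ℝ) + 1) ∧ x n = p + (k + (m + q)) + r := by
    obtain ⟨a, ha, har⟩ := hdense (x n) (1 / ((n : ℝ) + 1)) Nat.one_div_pos_of_nat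
    obtain ⟨p, hp, _, ha1, rfl⟩ :=
      Submodule.mem_sup.1 (sup_le_sup le_rfl h.sup_mul_alt_mul_sup_le ha)
    obtain ⟨k, hk, _, ha2, rfl⟩ := Submodule.mem_sup.1 ha1
    obtain ⟨m, hm, q, hq, rfl⟩ := Submodule.mem_sup.1 ha2
    exact ⟨p, hp, k, hk, m, hm, q, hq, _, har, (add_sub_cancel _ _).symm⟩
  choose p hp k hk m hm q hq r hr hsum using hex
  have hr0 : Tendsto (fun n => ‖toL2 τ (r n)‖) l (𝓝 0) :=
    squeeze_zero (fun _ => norm_nonneg _) (fun n => (hr n).le)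
      (tendsto_one_div_add_atTop_nhds_zero_nat.mono_left hl)
  have le1 : P₁ * 𝒲 ≤ P₁ * (𝒲 * 𝒩) := mul_le_mul_right (h.le_mul_sup _) _
  have le2 : P₁ * (𝒲 * P₁) ≤ P₁ * (𝒲 * 𝒩) :=
    mul_le_mul_right (mul_le_mul_right le_sup_right _) _
  have le3 : P₁ * (𝒲 * 𝒩) ≤ 𝒩 * (𝒲 * 𝒩) := mul_le_mul_left le_sup_right _
  have le4 : P₁ * (𝒲 * P₁) ≤ (𝒩 * 𝒲) * P₁ := by
    rw [← mul_assoc]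
    exact mul_le_mul_left (mul_le_mul_left le_sup_right _) _
  have le5 : P₁ * 𝒲 ≤ 𝒩 * 𝒲 := mul_le_mul_left le_sup_right _
  have hpk (n) : ⟪toL2 τ (p n), toL2 τ (k n)⟫_ℂ = 0 :=
    h.inner_sup_eq_zero (hp n) (h.le_sup_mul _ (hk n))
  have hpm (n) : ⟪toL2 τ (p n), toL2 τ (m n)⟫_ℂ = 0 :=
    h.inner_sup_eq_zero (hp n) (le3 (le1 (hm n)))
  have hpq (n) : ⟪toL2 τ (p n), toL2 τ (q n)⟫_ℂ = 0 :=
    h.inner_sup_eq_zero (hp n) (le3 (le2 (hq n)))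
  have hkm (n) : ⟪toL2 τ (k n), toL2 τ (m n)⟫_ℂ = 0 :=
    h.inner_left_eq_zero (hk n) (le1 (hm n))
  have hkq (n) : ⟪toL2 τ (k n), toL2 τ (q n)⟫_ℂ = 0 :=
    h.inner_left_eq_zero (hk n) (le2 (hq n))
  have hmq (n) : ⟪toL2 τ (m n), toL2 τ (q n)⟫_ℂ = 0 :=
    h.inner_right_eq_zero (le5 (hm n)) (le4 (hq n))
  -- By orthogonality ⟨p, p⟩ = ⟨p, x - r⟩ = ⟨p, e - r⟩, and both `e` and `r` tend to 0.
  have hp0 : Tendsto (fun n => ‖toL2 τ (p n)‖) l (𝓝 0) := by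
    have h2 := Tendsto.add he0 hr0
    rw [add_zero] at h2
    refine squeeze_zero (fun _ => norm_nonneg _) (fun n => ?_) h2
    refine le_trans ?_ (norm_toL2_sub_le τ (e n) (r n))
    refine norm_le_of_inner_self_eq ?_
    rw [inner_toL2_sub_right, ← he n _ (hp n), hsum, inner_toL2_add_right, inner_toL2_add_right,
      inner_toL2_add_right, inner_toL2_add_right, hpk, hpm, hpq,
      add_zero, add_zero, add_zero, add_sub_cancel_right]
  have hk0 : Tendsto (fun n => ‖toL2 τ (k n)‖) l (𝓝 0) := by
    refine tendsto_norm_toL2_zero_of_conj h.trace hτb hu (s := fun n => p n + (m n + q n)) (r := r)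
      (fun i => hcomm _ (huN i)) hx
      (fun i j n hij => h.inner_conj_eq_zero_of_mem_alt_sup (huN i) (huN j) (huP i j hij)
        (hk n) (hk n))
      (fun n => by rw [hsum]; abel) (fun n => ?_) hr0
    rw [inner_toL2_add_right, inner_toL2_add_right, hkm, hkq, inner_eq_zero_symm.1 (hpk n),
      add_zero, add_zero]
  have hm0 : Tendsto (fun n => ‖toL2 τ (m n)‖) l (𝓝 0) := by
    refine tendsto_norm_toL2_zero_of_conj h.trace hτb hu (s := fun n => p n + (k n + q n)) (r := r)
      (fun i => hcomm _ (huN i)) hx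
      (fun i j n hij => h.inner_conj_eq_zero_of_mem_sup_alt (huP i j hij)
        (le5 (hm n)) (le5 (hm n)))
      (fun n => by rw [hsum]; abel) (fun n => ?_) hr0
    rw [inner_toL2_add_right, inner_toL2_add_right, hmq, inner_eq_zero_symm.1 (hkm n),
      inner_eq_zero_symm.1 (hpm n), add_zero, add_zero]
  refine ⟨q, hq, ?_⟩
  have h2 := ((hp0.add hk0).add hm0).add hr0
  simp only [add_zero] at h2
  refine AsympEq.of_le h2 fun n => ?_
  have e2 : x n - q n = p n + k n + m n + r n := by rw [hsum]; abel
  rw [e2]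
  exact (norm_toL2_add_le _ _ _).trans (add_le_add_left ((norm_toL2_add_le _ _ _).trans
    (add_le_add_left (norm_toL2_add_le _ _ _) _)) _)

/-- For sequences as in `exists_asympEq`, multiplication by `N₁` is asymptotically compatible with
the words that begin and end in `N₁ ⊖ B`. -/
theorem IsFreeSplitting.exists_asympEq_mul (h : IsFreeSplitting τ B₀ P₁ P₂)
    (hq : ∀ n, q n ∈ P₁ * (𝒲 * P₁)) {c : A} (hc : c ∈ 𝒩)
    (hcomm : AsympEq τ l (fun n => q n * c) (fun n => c * q n)) :
    ∃ q' : ℕ → A, (∀ n, q' n ∈ P₁ * (𝒲 * P₁)) ∧ AsympEq τ l (fun n => q n * c) q' := by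
  have hex (n : ℕ) : ∃ m ∈ P₁ * 𝒲, ∃ q' ∈ P₁ * (𝒲 * P₁), q n * c = m + q' := by
    obtain ⟨m, hm, q', hq', e⟩ := Submodule.mem_sup.1
      (h.left_alt_left_mul_sup_le (Submodule.mul_mem_mul (hq n) hc))
    exact ⟨m, hm, q', hq', e.symm⟩
  choose m hm q' hq' e using hex
  refine ⟨q', hq', AsympEq.of_le hcomm fun n => ?_⟩
  have le4 : P₁ * (𝒲 * P₁) ≤ (𝒩 * 𝒲) * P₁ := by
    rw [← mul_assoc]
    exact mul_le_mul_left (mul_le_mul_left le_sup_right _) _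
  have le5 : P₁ * 𝒲 ≤ 𝒩 * 𝒲 := mul_le_mul_left le_sup_right _
  have hm' : m n ∈ 𝒩 * 𝒲 := le5 (hm n)
  have e1 : q n * c - q' n = m n := by rw [e, add_sub_cancel_right]
  rw [e1]
  -- The component `m` ends in P₂, so it is orthogonal to both `q'` and `c q`, which end in P₁. It
  -- is thus a component of the commutator.
  refine norm_le_of_inner_self_eq (w := toL2 τ (q n * c - c * q n)) ?_
  have h1 := h.inner_right_eq_zero hm'
    (h.sup_mul_left_alt_left_le (Submodule.mul_mem_mul hc (hq n)))
  have h2 := h.inner_right_eq_zero hm' (le4 (hq' n))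
  rw [inner_toL2_sub_right, h1, e, inner_toL2_add_right, h2, add_zero, sub_zero]

/-- The asymptotic orthogonality property for `y₁, y₂` in the span of the words with a letter in
`N₂ ⊖ B`. -/
theorem IsFreeSplitting.tendsto_inner (h : IsFreeSplitting τ B₀ P₁ P₂)
    (hτb : HasBoundedMul τ)
    (hq : ∀ n, q n ∈ P₁ * (𝒲 * P₁)) (hxq : AsympEq τ l x q)
    (hcomm : ∀ m ∈ 𝒩, AsympEq τ l (fun n => x n * m) (fun n => m * x n))
    {C : ℝ} (hx : ∀ n, ‖toL2 τ (x n)‖ ≤ C) {s t : A}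
    (hs : s ∈ 𝒩 * (𝒲 * 𝒩)) (ht : t ∈ 𝒩 * (𝒲 * 𝒩)) :
    Tendsto (fun n => ⟪toL2 τ (x n * s), toL2 τ (t * x n)⟫_ℂ) l (𝓝 0) := by
  have key : ∀ a ∈ 𝒩, ∀ w ∈ 𝒲, ∀ b ∈ 𝒩, ∀ a' ∈ 𝒩, ∀ w' ∈ 𝒲, ∀ b' ∈ 𝒩,
      Tendsto (fun n => ⟪toL2 τ (x n * (a * (w * b))),
        toL2 τ ((a' * (w' * b')) * x n)⟫_ℂ) l (𝓝 0) := by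
    intro a ha w hw b hb a' ha' w' hw' b' hb'
    -- These are the factors left after a' and b' have been moved past `x` to the other side of the
    -- inner product.
    have hc : star a' * a ∈ 𝒩 := h.sup_mul_sup (Submodule.mul_mem_mul (h.star_sup ha') ha)
    have hd : b * star b' ∈ 𝒩 := h.sup_mul_sup (Submodule.mul_mem_mul hb (h.star_sup hb'))
    set c := star a' * a with hc_def
    set d := b * star b' with hd_def
    have hqc : AsympEq τ l (fun n => q n * c) (fun n => c * q n) :=
      ((hxq.symm.mul_const hτb c).trans (hcomm c hc)).trans (hxq.const_mul hτb c)
    obtain ⟨q', hq', hqq'⟩ := h.exists_asympEq_mul hq hc hqc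
    have bound (y z : A) : ∃ D, ∀ n, ‖toL2 τ (y * (x n * z))‖ ≤ D := by
      obtain ⟨Cy, hCy, hy⟩ := hτb.mul_left y
      obtain ⟨Cz, hCz, hz⟩ := hτb.mul_right z
      refine ⟨Cy * (C * Cz), fun n => (hy _).trans ?_⟩
      gcongr
      exact (hz _).trans (by gcongr; exact hx n)
    obtain ⟨D₁, hD₁⟩ := bound (star a') (a * (w * b))
    obtain ⟨D₂, hD₂⟩ := bound (w' * b') 1
    obtain ⟨D₃, hD₃⟩ := bound 1 (c * (w * d))
    obtain ⟨D₄, hD₄⟩ := bound w' 1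
    simp only [mul_one, one_mul] at hD₂ hD₃ hD₄
    have A1 : AsympEq τ l (fun n => star a' * (x n * (a * (w * b))))
        (fun n => x n * (c * (w * b))) := by
      have := ((hcomm (star a') (h.star_sup ha')).mul_const hτb (a * (w * b))).symm
      simpa only [hc_def, mul_assoc] using this
    have A2 : AsympEq τ l (fun n => w' * (b' * x n)) (fun n => w' * (x n * b')) :=
      ((hcomm b' hb').const_mul hτb w').symm
    have A3 : AsympEq τ l (fun n => x n * (c * (w * d))) (fun n => q' n * (w * d)) := by
      have := ((hxq.mul_const hτb c).trans hqq').mul_const hτb (w * d)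
      simpa only [mul_assoc] using this
    have A4 : AsympEq τ l (fun n => w' * x n) (fun n => w' * q n) := hxq.const_mul hτb w'
    have T1 := A1.tendsto_inner_sub A2 hD₁ fun n => by rw [← mul_assoc]; exact hD₂ n
    have T2 := A3.tendsto_inner_sub A4 hD₃ hD₄
    have T3 := T1.add T2
    rw [add_zero] at T3
    refine T3.congr fun n => ?_
    have E1 : ⟪toL2 τ (star a' * (x n * (a * (w * b)))), toL2 τ (w' * (b' * x n))⟫_ℂ =
        ⟪toL2 τ (x n * (a * (w * b))), toL2 τ ((a' * (w' * b')) * x n)⟫_ℂ := by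
      rw [inner_toL2, inner_toL2, star_mul, star_star]
      simp only [mul_assoc]
    have E2 : ⟪toL2 τ (x n * (c * (w * b))), toL2 τ (w' * (x n * b'))⟫_ℂ =
        ⟪toL2 τ (x n * (c * (w * d))), toL2 τ (w' * x n)⟫_ℂ := by
      have e1 : x n * (c * (w * d)) = x n * (c * (w * b)) * star b' := by
        simp only [hd_def, mul_assoc]
      rw [inner_toL2, inner_toL2, e1, star_mul _ (star b'), star_star, ← mul_assoc w',
        ← mul_assoc, h.trace, ← mul_assoc]
    -- The first vector begins in P₁, the second in P₂.
    have E3 : ⟪toL2 τ (q' n * (w * d)), toL2 τ (w' * q n)⟫_ℂ = 0 :=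
      inner_eq_zero_symm.1 (h.inner_left_eq_zero
        (alt_mul_left_alt_left_le (Submodule.mul_mem_mul hw' (hq n)))
        (left_alt_left_mul_le (Submodule.mul_mem_mul (hq' n) (Submodule.mul_mem_mul hw hd))))
    rw [E1, E2, E3, sub_zero, sub_add_cancel]
  induction hs using Submodule.mul_induction_on' with
  | mem_mul_mem a ha s hs =>
    induction hs using Submodule.mul_induction_on' with
    | mem_mul_mem w hw b hb =>
      induction ht using Submodule.mul_induction_on' with
      | mem_mul_mem a' ha' t ht =>
        induction ht using Submodule.mul_induction_on' with
        | mem_mul_mem w' hw' b' hb' => exact key a ha w hw b hb a' ha' w' hw' b' hb'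
        | add t _ t' _ ht ht' =>
          simp_rw [mul_add, add_mul, inner_toL2_add_right]
          have h2 := ht.add ht'
          rwa [add_zero] at h2
      | add t _ t' _ ht ht' =>
        simp_rw [add_mul, inner_toL2_add_right]
        have h2 := ht.add ht'
        rwa [add_zero] at h2
    | add s _ s' _ hs hs' =>
      simp_rw [mul_add, inner_toL2_add_left]
      have h2 := hs.add hs'
      rwa [add_zero] at h2
  | add s _ s' _ hs hs' =>
    simp_rw [mul_add, inner_toL2_add_left]
    have h2 := hs.add hs'
    rwa [add_zero] at h2

end Splitting

/-! ### Approximation by reduced words -/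

section Approximation

variable {A : Type*} [Ring A] [StarRing A] [Algebra ℂ A] [StarModule ℂ A]
  {τ : PosFunctional A} {B₀ P₁ P₂ : Submodule ℂ A} {l : Filter ℕ} {x q : ℕ → A}

local notation "𝒩" => B₀ ⊔ P₁
local notation "𝒲" => altSpan P₁ P₂

/-- An element orthogonal to `N₁` is approximated by sums of words with a letter in `N₂ ⊖ B`. -/
theorem IsFreeSplitting.exists_norm_toL2_sub_lt (h : IsFreeSplitting τ B₀ P₁ P₂)
    (hdense : ∀ (y : A) (ε : ℝ), 0 < ε → ∃ a ∈ 𝒩 ⊔ 𝒩 * (𝒲 * 𝒩), ‖toL2 τ (y - a)‖ < ε)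
    {y : A} (hy : ∀ m ∈ 𝒩, ⟪toL2 τ m, toL2 τ y⟫_ℂ = 0) {ε : ℝ} (hε : 0 < ε) :
    ∃ s ∈ 𝒩 * (𝒲 * 𝒩), ‖toL2 τ (y - s)‖ < ε := by
  obtain ⟨a, ha, hlt⟩ := hdense y (ε / 2) (half_pos hε)
  obtain ⟨p, hp, s, hs, rfl⟩ := Submodule.mem_sup.1 ha
  refine ⟨s, hs, ?_⟩
  -- Both `s` and `y` are orthogonal to `p`, so dropping `p` at most doubles the error.
  have h1 : ‖toL2 τ p‖ ≤ ‖toL2 τ (p + s - y)‖ := norm_le_of_inner_self_eq (by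
    rw [inner_toL2_sub_right, inner_toL2_add_right, h.inner_sup_eq_zero hp hs, hy p hp, add_zero,
      sub_zero])
  rw [← neg_sub, map_neg, norm_neg] at h1
  have e : y - s = (y - (p + s)) + p := by abel
  rw [e]
  linarith [norm_toL2_add_le τ (y - (p + s)) p]

theorem tendsto_zero_of_forall_exists {f : ℕ → ℂ}
    (h : ∀ ε > 0, ∃ g : ℕ → ℂ, Tendsto g l (𝓝 0) ∧ ∀ n, ‖f n - g n‖ ≤ ε) :
    Tendsto f l (𝓝 0) := by
  rw [Metric.tendsto_nhds]
  intro ε hε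
  obtain ⟨g, hg, hfg⟩ := h (ε / 2) (half_pos hε)
  filter_upwards [Metric.tendsto_nhds.1 hg (ε / 2) (half_pos hε)] with n hn
  rw [dist_zero_right] at hn ⊢
  have := norm_add_le (f n - g n) (g n)
  rw [sub_add_cancel] at this
  linarith [hfg n]

/-- The asymptotic orthogonality property for arbitrary elements orthogonal to `N₁`. -/
theorem tendsto_inner_of_dense {S T : Set A} {C : ℝ}
    (hxl : ∀ n y, ‖toL2 τ (x n * y)‖ ≤ C * ‖toL2 τ y‖)
    (hxr : ∀ n y, ‖toL2 τ (y * x n)‖ ≤ C * ‖toL2 τ y‖)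
    (hST : ∀ s ∈ S, ∀ t ∈ T, Tendsto (fun n => ⟪toL2 τ (x n * s), toL2 τ (t * x n)⟫_ℂ) l (𝓝 0))
    {y₁ y₂ : A} (hy₁ : ∀ ε > 0, ∃ s ∈ S, ‖toL2 τ (y₁ - s)‖ < ε)
    (hy₂ : ∀ ε > 0, ∃ t ∈ T, ‖toL2 τ (y₂ - t)‖ < ε) :
    Tendsto (fun n => ⟪toL2 τ (x n * y₁), toL2 τ (y₂ * x n)⟫_ℂ) l (𝓝 0) := by
  have hbound (n : ℕ) (y z : A) : ‖⟪toL2 τ (x n * y), toL2 τ (z * x n)⟫_ℂ‖ ≤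
      C ^ 2 * ‖toL2 τ y‖ * ‖toL2 τ z‖ := by
    refine (norm_inner_le_norm _ _).trans ?_
    refine (mul_le_mul (hxl n y) (hxr n z) (norm_nonneg _)
      ((norm_nonneg _).trans (hxl n y))).trans (le_of_eq ?_)
    ring
  have step : ∀ t ∈ T,
      Tendsto (fun n => ⟪toL2 τ (x n * y₁), toL2 τ (t * x n)⟫_ℂ) l (𝓝 0) := by
    refine fun t ht => tendsto_zero_of_forall_exists fun ε hε => ?_
    -- The added 1 keeps the divisor positive when `C` or ‖t‖₂ is zero.
    have hK : 0 < C ^ 2 * ‖toL2 τ t‖ + 1 := by positivity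
    obtain ⟨s, hs, hlt⟩ := hy₁ (ε / (C ^ 2 * ‖toL2 τ t‖ + 1)) (by positivity)
    refine ⟨_, hST s hs t ht, fun n => ?_⟩
    rw [← inner_toL2_sub_left, ← mul_sub]
    refine (hbound _ _ _).trans ?_
    rw [lt_div_iff₀ hK] at hlt
    nlinarith [norm_nonneg (toL2 τ (y₁ - s))]
  refine tendsto_zero_of_forall_exists fun ε hε => ?_
  have hK : 0 < C ^ 2 * ‖toL2 τ y₁‖ + 1 := by positivity
  obtain ⟨t, ht, hlt⟩ := hy₂ (ε / (C ^ 2 * ‖toL2 τ y₁‖ + 1)) (by positivity)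
  refine ⟨_, step t ht, fun n => ?_⟩
  rw [← inner_toL2_sub_right, ← sub_mul]
  refine (hbound _ _ _).trans ?_
  rw [lt_div_iff₀ hK] at hlt
  nlinarith [norm_nonneg (toL2 τ (y₂ - t))]

end Approximation

/-! ### Representatives of elements of the ultrapower -/

section Representatives

variable {HN HM : Type*} [NormedAddCommGroup HN] [InnerProductSpace ℂ HN] [CompleteSpace HN]
  [NormedAddCommGroup HM] [InnerProductSpace ℂ HM] [CompleteSpace HM]
  {N : TracialVNA HN} {M : TracialVNA HM} (j : Inclusion N M) (ω : Ultrafilter ℕ)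

theorem asympEq_of_mem_centralizer {x : BddSeq M}
    (hx : Ultrapower.mk M ω x ∈ Set.centralizer (toUltra M ω '' Set.range j)) (a : N) :
    AsympEq M.tr ω (fun n => (x : ℕ → M) n * j a) (fun n => j a * (x : ℕ → M) n) := by
  have h1 : toUltra M ω (j a) * Ultrapower.mk M ω x = Ultrapower.mk M ω x * toUltra M ω (j a) :=
    hx _ ⟨_, ⟨a, rfl⟩, rfl⟩
  rw [toUltra, ← map_mul, ← map_mul, eq_comm, Ultrapower.mk_eq_mk_iff] at h1
  exact h1

/-- The conditional expectations onto `N` of a sequence that represents an element of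
`M^ω ⊖ N^ω` vanish asymptotically. -/
theorem exists_tendsto_of_mem_ominus {x : BddSeq M}
    (hx : Ultrapower.mk M ω x ∈ ominus (ultraTr M ω) (subUltra M ω (Set.range j))) :
    ∃ e : ℕ → M, (∀ n a, ⟪toL2 M.tr (j a), toL2 M.tr ((x : ℕ → M) n)⟫_ℂ =
      ⟪toL2 M.tr (j a), toL2 M.tr (e n)⟫_ℂ) ∧
      Tendsto (fun n => ‖toL2 M.tr (e n)‖) ω (𝓝 0) := by
  obtain ⟨C, hC⟩ := x.2
  choose e he hcond using fun n => j.exists_isCondExp ((x : ℕ → M) n)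
  have key (n : ℕ) (a : N) : ⟪toL2 M.tr (j a), toL2 M.tr ((x : ℕ → M) n)⟫_ℂ =
      ⟪toL2 M.tr (j a), toL2 M.tr (j (e n))⟫_ℂ := by
    rw [inner_toL2, inner_toL2, ← j.map_star, hcond n, ← j.map_mul, j.tr_map]
  refine ⟨fun n => j (e n), key, ?_⟩
  -- Contractivity of the expectation makes this a bounded sequence, hence an element of N^ω.
  -- Orthogonality of x to it reads lim ‖eₙ‖₂² = 0.
  let z : BddSeq M := ⟨fun n => j (e n), C, fun n => (j.norm_le _).trans ((he n).trans (hC n))⟩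
  have h0 := hx (Ultrapower.mk M ω z) ⟨z, fun n => ⟨_, rfl⟩, rfl⟩
  have hlim := tendsto_ultraTr M ω (star z * x)
  rw [inner_toL2, Ultrapower.star_mk, ← map_mul] at h0
  rw [h0] at hlim
  have hsq : Tendsto (fun n => ‖toL2 M.tr (j (e n))‖ ^ 2) ω (𝓝 0) := by
    have hre := (Complex.continuous_re.tendsto _).comp hlim
    rw [Complex.zero_re] at hre
    refine hre.congr fun n => ?_
    rw [norm_toL2_sq, ← inner_toL2, ← key, inner_toL2]
    rfl
  have := hsq.sqrt
  simpa using this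

end Representatives

end TracialVN

end

/-! ### The asymptotic orthogonality property -/

theorem mainTheorem3
    {HB HN₁ HN₂ HM : Type*}
    [NormedAddCommGroup HB] [InnerProductSpace ℂ HB] [CompleteSpace HB]
    [NormedAddCommGroup HN₁] [InnerProductSpace ℂ HN₁] [CompleteSpace HN₁]
    [NormedAddCommGroup HN₂] [InnerProductSpace ℂ HN₂] [CompleteSpace HN₂]
    [NormedAddCommGroup HM] [InnerProductSpace ℂ HM] [CompleteSpace HM]
    (B : TracialVNA HB) (N₁ : TracialVNA HN₁) (N₂ : TracialVNA HN₂) (M : TracialVNA HM)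
    (i₁ : Inclusion B N₁) (i₂ : Inclusion B N₂) (j₁ : Inclusion N₁ M) (j₂ : Inclusion N₂ M)
    (hM : IsAmalgamatedFreeProduct i₁ i₂ j₁ j₂)
    {I : Type*} [Infinite I] (u : I → N₁) (hu : IsPimsnerPopaBasis i₁ u)
    (hu_unitary : ∀ k, u k ∈ unitary N₁)
    (ω : Ultrafilter ℕ) (hω : (ω : Filter ℕ) ≤ Filter.cofinite)
    (y₁ y₂ : M) (hy₁ : y₁ ∈ ominus M.tr (Set.range j₁)) (hy₂ : y₂ ∈ ominus M.tr (Set.range j₁))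
    (x : Ultrapower M ω)
    (hx_comm : x ∈ Set.centralizer (toUltra M ω '' Set.range j₁))
    (hx : x ∈ ominus (ultraTr M ω) (subUltra M ω (Set.range j₁))) :
    inner ℂ (toL2 (ultraTr M ω) (x * toUltra M ω y₁)) (toL2 (ultraTr M ω) (toUltra M ω y₂ * x)) =
      0 := by
  obtain ⟨x, rfl⟩ := Ultrapower.mk_surjective M ω x
  obtain ⟨C, hC⟩ := x.2
  obtain ⟨e, he, he0⟩ := exists_tendsto_of_mem_ominus j₁ ω hx
  have hF := hM.isFreeSplitting
  have hN := i₁.range_lin_sup_map_compl j₁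
  have hdense : ∀ (y : M) (ε : ℝ), 0 < ε → ∃ a ∈ _, ‖toL2 M.tr (y - a)‖ < ε :=
    fun y ε hε => hM.exists_norm_toL2_sub_lt y hε
  rw [← hN] at hdense
  -- Freeness of ω makes the approximation errors 1 / (n + 1) vanish along ω.
  have hl : (ω : Filter ℕ) ≤ atTop := hω.trans Nat.cofinite_eq_atTop.le
  have hcomm : ∀ m ∈ LinearMap.range (j₁.comp i₁).lin ⊔ i₁.compl.map j₁.lin,
      AsympEq M.tr ω (fun n => (x : ℕ → M) n * m) (fun n => m * (x : ℕ → M) n) := by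
    rw [hN]
    rintro _ ⟨a, rfl⟩
    exact asympEq_of_mem_centralizer j₁ ω hx_comm a
  have hC2 (n : ℕ) : ‖toL2 M.tr ((x : ℕ → M) n)‖ ≤ C := (M.norm_toL2_le _).trans (hC n)
  obtain ⟨q, hq, hxq⟩ := hF.exists_asympEq M.hasBoundedMul hdense hl (u := fun k => j₁ (u k))
    (fun k => by rw [← j₁.map_star, ← j₁.map_mul, (hu_unitary k).1, j₁.map_one])
    (fun k => by rw [hN]; exact ⟨u k, rfl⟩)
    (fun k l hkl => by
      rw [← j₁.map_star, ← j₁.map_mul]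
      exact ⟨_, (hu.condExp_eq_zero k l hkl).mem_compl, rfl⟩)
    hcomm hC2 (fun n => by
      rw [hN]
      rintro _ ⟨a, rfl⟩
      exact he n a) he0
  have happrox {y : M} (hy : y ∈ ominus M.tr (Set.range j₁)) :
      ∀ ε > 0, ∃ s ∈ _, ‖toL2 M.tr (y - s)‖ < ε := fun ε hε =>
    hF.exists_norm_toL2_sub_lt hdense (by
      rw [hN]
      rintro _ ⟨a, rfl⟩
      exact hy _ ⟨a, rfl⟩) hε
  have hlim := tendsto_inner_of_dense (x := (x : ℕ → M)) (l := ω)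
    (fun n y => (M.norm_toL2_mul_le _ _).trans
      (mul_le_mul_of_nonneg_right (hC n) (norm_nonneg _)))
    (fun n y => (M.norm_toL2_mul_le' _ _).trans (by
      rw [mul_comm]
      exact mul_le_mul_of_nonneg_right (hC n) (norm_nonneg _)))
    (fun s hs t ht => hF.tendsto_inner M.hasBoundedMul hq hxq hcomm hC2 hs ht)
    (happrox hy₁) (happrox hy₂)
  have hlim' := tendsto_ultraTr M ω (star (x * constSeq M y₁) * (constSeq M y₂ * x))
  rw [inner_toL2, toUltra, toUltra, ← map_mul, ← map_mul, Ultrapower.star_mk, ← map_mul]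
  refine tendsto_nhds_unique hlim' (hlim.congr fun n => ?_)
  rw [inner_toL2]
  rfl
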